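/- \textbf{Setting.} Let $N=N(n)$, $n\ge 1$, be integers with $c_n=N(n)/n\to c>0$. Let $D_n=\mathrm{diag}(d^n_1,\dots,d^n_n)$ be deterministic nonnegative diagonal matrices such that $\nu_n=\frac1n\sum_{k}\delta_{d^n_k}$ converges weakly to a probability measure $\nu$ with compact support and $\max_{k}\mathrm{dist}(d^n_k,\mathrm{supp}\,\nu)\to 0$. Let $\mu$ be the probability measure whose Stieltjes transform $\mathbf m(z)=\int\frac{\mu(dt)}{t-z}$ satisfies $\mathbf m(z)=\bigl(-z+\int\frac{t}{1+c\,\mathbf m(z)t}\,\nu(dt)\bigr)^{-1}$ for $\operatorname{Im}z>0$, and let $\mu_n$, with Stieltjes transform $m_n$, be the probability measure obtained in the same way with $(c_n,\nu_n)$ in place of $(c,\nu)$. For real $x$ outside the support of the measure, $\mathbf m(x)$ and $m_n(x)$ denote the same integrals. Let $P_n$ be deterministic $N\times n$ complex matrices with $\sup_n\|P_n\|<\infty$ (spectral norm) and, for all large $n$, rank $r=j_1+\dots+j_t$, where $t\ge1$ and $j_1,\dots,j_t\ge1$ are fixed. Let $\Omega=\mathrm{diag}(\omega_1^2I_{j_1},\dots,\omega_t^2I_{j_t})$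 with $\omega_1^2>\dots>\omega_t^2>0$. For all large $n$ let $P_n=U_nR_n^*$ with $U_n\in\mathbb C^{N\times r}$, $U_n^*U_n=I_r$, and let $\Lambda_n(dt)=R_n^*\,\mathrm{diag}(\delta_{d_1^n}(dt),\dots,\delta_{d_n^n}(dt))\,R_n$. Assume that $\int f\,d\Lambda_n\to\bigl(\int f\,d\nu\bigr)\Omega$ for all bounded continuous $f:\mathbb R\to\mathbb R$, that $\sup_n\sqrt n\,|c_n-c|<\infty$ and that, for every $x\in\mathbb R\setminus\mathrm{supp}\,\nu$, \[\limsup_n\sqrt n\,\Bigl|\int\frac{\nu_n(dt)}{t-x}-\int\frac{\nu(dt)}{t-x}\Bigr|<\infty,\qquad \limsup_n\sqrt n\,\Bigl\|\int\frac{\Lambda_n(dt)}{t-x}-\int\frac{\nu(dt)}{t-x}\,\Omega\Bigr\|<\infty .\] Put $B_\mu=\sup\mathrm{supp}\,\mu$, $g(x)=\mathbf m(x)\,(c\,x\,\mathbf m(x)-1+c)$ and $H_n(x)=\int\frac{m_n(x)}{1+c_nm_n(x)t}\,\Lambda_n(dt)$. \textbf{Statement.} Assume that $\omega_1^2g(x)=1$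 has a solution in $(B_\mu,\infty)$. Then there are $1\le p\le t$ and $\rho_1>\dots>\rho_p$ in $(B_\mu,\infty)$ such that, in $(B_\mu,\infty)$, $\rho_i$ is the only solution of $\omega_i^2g(x)=1$ for $i\le p$, and $\omega_\ell^2g(x)=1$ has no solution for $\ell>p$. Moreover, for every $i=1,\dots,p$: \begin{itemize} \item $1+c\,\mathbf m(\rho_i)t\ne0$ for all $t\in\mathrm{supp}\,\nu$, and $\displaystyle\Delta(\rho_i)=1-c\int\Bigl(\frac{\mathbf m(\rho_i)t}{1+c\,\mathbf m(\rho_i)t}\Bigr)^2\nu(dt)>0$; \item for all large $n$, $\rho_i\notin\mathrm{supp}\,\mu_n$ and $1+c_nm_n(\rho_i)d^n_k\ne0$ for all $k$ (so that $H_n(\rho_i)$ is well defined), and the $i$-th diagonal block $H_{i,n}(\rho_i)\in\mathbb C^{j_i\times j_i}$ of $H_n(\rho_i)$ satisfies $\displaystyle\limsup_n\bigl\|\sqrt n\,(H_{i,n}(\rho_i)+I_{j_i})\bigr\|<\infty$. \end{itemize} -/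

import Mathlib

open MeasureTheory Filter Topology
open scoped Matrix Matrix.Norms.L2Operator BoundedContinuousFunction

noncomputable section

namespace Spiked

/-- The Stieltjes transform `z ↦ ∫ (t - z)⁻¹ μ(dt)` of a measure on the line, for `z` in `ℂ`,
or for a real `z` (this is meant for `z` outside the support of `μ`, where the two agree). -/
def stieltjes {𝕜 : Type} [RCLike 𝕜] (μ : Measure ℝ) (z : 𝕜) : 𝕜 :=
  resolventTransform μ z

/-- The empirical probability measure `n⁻¹ ∑ j, δ_{d j}` of a list of `n` real numbers. -/
def empirical {n : ℕ} (d : Fin n → ℝ) : Measure ℝ :=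
  (n : ENNReal)⁻¹ • ∑ j, Measure.dirac (d j)

/-- `μ` is the probability measure associated with the ratio `c` and the measure `ν`: its
Stieltjes transform `m` satisfies, at every point `z` of the upper half plane,
`m(z) = (-z + ∫ t / (1 + c m(z) t) ν(dt))⁻¹`.
(The Stieltjes transform of a probability measure maps the upper half plane into itself.) -/
structure IsLimitLaw (c : ℝ) (ν μ : Measure ℝ) : Prop where
  isProbabilityMeasure : IsProbabilityMeasure μ
  equation : ∀ z : ℂ, 0 < z.im →
    stieltjes μ z = (-z + ∫ t : ℝ, (t : ℂ) / (1 + c * stieltjes μ z * t) ∂ν)⁻¹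

/-- The interval `(sup (supp μ), ∞)`. -/
def rightOfSupport (μ : Measure ℝ) : Set ℝ :=
  {x | (⨆ t ∈ μ.support, (t : EReal)) < (x : EReal)}

/-- The function `g(x) = m(x) (c x m(x) - 1 + c)`, where `m` is the Stieltjes transform of `μ`. -/
def g (c : ℝ) (μ : Measure ℝ) (x : ℝ) : ℝ :=
  stieltjes μ x * (c * x * stieltjes μ x - 1 + c)

/-- `Δ(x) = 1 - c ∫ (m(x) t / (1 + c m(x) t))² ν(dt)`, where `m` is the Stieltjes transform
of `μ`. -/
def Delta (c : ℝ) (ν μ : Measure ℝ) (x : ℝ) : ℝ :=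
  1 - c * ∫ t, (stieltjes μ x * t / (1 + c * stieltjes μ x * t)) ^ 2 ∂ν

/-- The integral `∫ f(t) Λ(dt)` of a real function against the matrix-valued measure
`Λ(dt) = R* diag(δ_{d_1}(dt), …, δ_{d_n}(dt)) R`. -/
def integralLambda {n : ℕ} {s : Type} (d : Fin n → ℝ) (R : Matrix (Fin n) s ℂ) (f : ℝ → ℝ) :
    Matrix s s ℂ :=
  Rᴴ * Matrix.diagonal (fun j => (f (d j) : ℂ)) * R

/-- `H(x) = ∫ m(x) / (1 + c m(x) t) Λ(dt)`, where `m` is the Stieltjes transform of `μ` and `Λ`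
is the matrix-valued measure associated with `d` and `R`. -/
def H {n : ℕ} {s : Type} (c : ℝ) (μ : Measure ℝ) (d : Fin n → ℝ) (R : Matrix (Fin n) s ℂ)
    (x : ℝ) : Matrix s s ℂ :=
  integralLambda d R (fun t => stieltjes μ x / (1 + c * stieltjes μ x * t))

/-- The block diagonal matrix with diagonal blocks `ω_1² I_{j_1}, …, ω_t² I_{j_t}`. -/
def Omega {t : ℕ} (j : Fin t → ℕ) (ω : Fin t → ℝ) :
    Matrix (Σ l, Fin (j l)) (Σ l, Fin (j l)) ℂ :=
  Matrix.diagonal (fun a => ((ω a.1 ^ 2 : ℝ) : ℂ))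

/-- `limsup u_n < ∞` for a real sequence: the sequence is eventually bounded above. -/
def LimsupFinite (u : ℕ → ℝ) : Prop :=
  IsBoundedUnder (· ≤ ·) atTop u

end Spiked

end

/-!
The argument works with the subordination function `σ(z) = -1 / (c m(z))` instead of the Stieltjes
transform `m` of `μ`. In terms of `σ` the equation of the law reads `z = Z(σ(z))` with
`Z(s) = c s + ∫ s t / (s - t) ν(dt)`, and `Z` satisfies the difference identity
`Z(σ) - Z(s) = (σ - s) (c - ∫ t² / ((σ - t) (s - t)) ν(dt))` (`subordInv_sub_subordInv`).

The imaginary part of the equation is `Im z = Im σ (c - ∫ |t / (σ - t)|² ν(dt))`, hence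
`∫ |t / (σ(z) - t)|² ν(dt) ≤ c` on the whole upper half plane (`IsLimitLaw.im_eq`,
`IsLimitLaw.sqIntegral_le`). Two things follow.

* To the right of the support of `μ`, where `σ` is real, continuous and increasing, this bound makes
  the `ν`-mass of an interval of length `r` around a value of `σ` at most `O(r²)`, so that `σ`
  avoids the support of `ν`; as it tends to infinity, it stays to the right of that support
  (`IsLimitLaw.lt_subord`). There `∫ (t / (σ - t))² ν(dt) < c`, which is the positivity of `Δ`, and
  `g(x) = c⁻¹ ∫ (σ(x) - t)⁻¹ ν(dt)` is strictly decreasing and tends to zero at infinity. The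
  intermediate value theorem then gives the solutions `ρ_i`.
* If `s` satisfies `∫ (t / (s - t))² ν(dt) ≤ c - 2 δ`, then `δ |σ(z) - s| ≤ |z - Z(s)|` for *every*
  `z` in the upper half plane (`IsLimitLaw.norm_subord_sub_le`): the bounds for `σ(z)` and `s`
  control the mixed integral in the difference identity.

The second fact is applied to the law `μ_n`, with ratio `c_n` and measure `ν_n`, at the fixed point
`s = σ(ρ_i)` of the limit law. It shows that `σ_n` stays near `s` above a neighbourhood of `ρ_i`,
that `μ_n` has no mass there, and that `δ |σ_n(ρ_i) - s| ≤ |ρ_i - Z_n(s)|`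
(`IsLimitLaw.outlier_stable`). Since
`s t / (s - t) = -s - s² / (t - s)`, the right side is controlled by `c_n - c` and by the difference
of the Stieltjes transforms of `ν_n` and `ν` at `s`, hence is `O(n^(-1/2))`. Finally
`H_n(ρ_i) = c_n⁻¹ ∫ (t - σ_n(ρ_i))⁻¹ Λ_n(dt)` differs by `O(n^(-1/2))` from
`c⁻¹ ∫ (t - s)⁻¹ Λ_n(dt)`, and so from `-g(ρ_i) Ω` (`outlier_convergence`), whose `i`-th block
is `-I`.
-/

noncomputable section

namespace Spiked

/-! ### Points outside the support of a measure -/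

/-- If near `a` the mass of an interval is at most quadratic in its length, then the distribution
function is constant near `a`, so that `a` is not in the support. -/
lemma notMem_support_of_measureReal_Icc_le {ν : Measure ℝ} [IsFiniteMeasure ν] {a K ε : ℝ}
    (hε : 0 < ε)
    (h : ∀ s, |s - a| < ε → ∀ r, 0 < r → r < ε → ν.real (Set.Icc (s - r) (s + r)) ≤ K * r ^ 2) :
    a ∉ ν.support := by
  set F : ℝ → ℝ := fun s => ν.real (Set.Iic s) with hF
  have hdiff : ∀ x y, x ≤ y → F y - F x = ν.real (Set.Ioc x y) := by
    intro x y hxy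
    rw [← Set.Iic_sdiff_Iic, measureReal_sdiff (Set.Iic_subset_Iic.2 hxy) measurableSet_Iic]
  have hquad : ∀ x, |x - a| < ε → ∀ y, |y - x| < ε → ‖F y - F x‖ ≤ K * ‖(y - x) ^ 2‖ := by
    intro x hx y hy
    rcases eq_or_ne y x with rfl | hne
    · simp
    have hr : 0 < |y - x| := abs_pos.2 (sub_ne_zero.2 hne)
    have hb := h x hx _ hr hy
    rw [norm_pow, Real.norm_eq_abs, Real.norm_eq_abs]
    refine le_trans ?_ hb
    rcases le_total x y with hxy | hxy
    · rw [hdiff x y hxy, abs_of_nonneg measureReal_nonneg]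
      refine measureReal_mono ?_
      rw [abs_of_nonneg (sub_nonneg.2 hxy)]
      intro t ht
      exact ⟨by linarith [ht.1], by linarith [ht.2]⟩
    · rw [abs_sub_comm, hdiff y x hxy, abs_of_nonneg measureReal_nonneg]
      refine measureReal_mono ?_
      rw [abs_of_nonpos (sub_nonpos.2 hxy)]
      intro t ht
      exact ⟨by linarith [ht.1], by linarith [ht.2]⟩
  have hderiv : ∀ x ∈ Metric.ball a ε, HasDerivWithinAt F 0 (Metric.ball a ε) x := by
    intro x hx
    have hx' : |x - a| < ε := by simpa [Real.dist_eq] using hx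
    refine HasDerivAt.hasDerivWithinAt ?_
    rw [hasDerivAt_iff_isLittleO]
    simp only [smul_zero, sub_zero]
    refine Asymptotics.IsBigO.trans_isLittleO (g := fun y => (y - x) ^ 2) ?_ ?_
    · refine Asymptotics.IsBigO.of_bound K ?_
      filter_upwards [Metric.ball_mem_nhds x hε] with y hy
      exact hquad x hx' y (by simpa [Real.dist_eq] using hy)
    · refine Asymptotics.IsLittleO.of_norm_left ?_
      simpa only [norm_pow] using Asymptotics.isLittleO_pow_sub_sub x one_lt_two
  rw [Measure.notMem_support_iff_exists]
  refine ⟨Set.Ioc (a - ε / 2) (a + ε / 2), Ioc_mem_nhds (by linarith) (by linarith), ?_⟩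
  have hconst := (convex_ball a ε).norm_image_sub_le_of_norm_hasDerivWithin_le (C := 0) hderiv
    (fun x _ => by simp) (x := a - ε / 2) (y := a + ε / 2)
    (by simp [abs_of_pos hε]; linarith)
    (by simp [abs_of_pos hε]; linarith)
  rw [hdiff _ _ (by linarith), zero_mul] at hconst
  have h0 := norm_le_zero_iff.1 hconst
  rwa [measureReal_eq_zero_iff] at h0

/-! ### Stieltjes transforms -/

lemma stieltjes_complex (μ : Measure ℝ) (z : ℂ) : stieltjes μ z = ∫ t : ℝ, ((t : ℂ) - z)⁻¹ ∂μ := by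
  simp [stieltjes, resolventTransform_apply, resolvent, Ring.inverse_eq_inv']

lemma stieltjes_real (μ : Measure ℝ) (x : ℝ) : stieltjes μ x = ∫ t : ℝ, (t - x)⁻¹ ∂μ := by
  simp [stieltjes, resolventTransform_apply, resolvent, Ring.inverse_eq_inv']

lemma im_le_norm_ofReal_sub {z : ℂ} (hz : 0 < z.im) (t : ℝ) : z.im ≤ ‖(t : ℂ) - z‖ := by
  have := Complex.abs_im_le_norm ((t : ℂ) - z)
  simpa [abs_of_pos hz] using this

lemma integrable_inv_ofReal_sub (μ : Measure ℝ) [IsFiniteMeasure μ] {z : ℂ} (hz : 0 < z.im) :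
    Integrable (fun t : ℝ => ((t : ℂ) - z)⁻¹) μ := by
  refine Integrable.of_bound (C := z.im⁻¹) (by fun_prop) (ae_of_all _ fun t => ?_)
  rw [norm_inv]
  exact inv_anti₀ hz (im_le_norm_ofReal_sub hz t)

lemma im_inv_ofReal_sub (z : ℂ) (t : ℝ) :
    (((t : ℂ) - z)⁻¹).im = z.im / ‖(t : ℂ) - z‖ ^ 2 := by
  rw [Complex.inv_im, Complex.normSq_eq_norm_sq]
  simp

lemma stieltjes_im (μ : Measure ℝ) [IsFiniteMeasure μ] {z : ℂ} (hz : 0 < z.im) :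
    (stieltjes μ z).im = ∫ t : ℝ, z.im / ‖(t : ℂ) - z‖ ^ 2 ∂μ := by
  rw [stieltjes_complex]
  have := Complex.imCLM.integral_comp_comm (integrable_inv_ofReal_sub μ hz)
  simp only [Complex.imCLM_apply] at this
  rw [← this]
  exact integral_congr_ae (ae_of_all _ fun t => im_inv_ofReal_sub z t)

lemma integrable_im_div (μ : Measure ℝ) [IsFiniteMeasure μ] {z : ℂ} (hz : 0 < z.im) :
    Integrable (fun t : ℝ => z.im / ‖(t : ℂ) - z‖ ^ 2) μ := by
  have := Complex.imCLM.integrable_comp (integrable_inv_ofReal_sub μ hz)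
  simp only [Complex.imCLM_apply] at this
  exact this.congr (ae_of_all _ fun t => im_inv_ofReal_sub z t)

lemma stieltjes_im_pos (μ : Measure ℝ) [IsProbabilityMeasure μ] {z : ℂ} (hz : 0 < z.im) :
    0 < (stieltjes μ z).im := by
  have hpos : ∀ t : ℝ, 0 < z.im / ‖(t : ℂ) - z‖ ^ 2 := fun t => by
    have := lt_of_lt_of_le hz (im_le_norm_ofReal_sub hz t)
    positivity
  rw [stieltjes_im μ hz, integral_pos_iff_support_of_nonneg (fun t => (hpos t).le)
    (integrable_im_div μ hz)]
  have : Function.support (fun t : ℝ => z.im / ‖(t : ℂ) - z‖ ^ 2) = Set.univ :=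
    Set.eq_univ_of_forall fun t => (hpos t).ne'
  simp [this]

/-- A Stieltjes transform whose imaginary part is `O(η)` at height `η` above a neighbourhood
of `a` comes from a measure without mass near `a`. -/
lemma notMem_support_of_stieltjes_im_le {μ : Measure ℝ} [IsFiniteMeasure μ] {a K r : ℝ}
    (hr : 0 < r)
    (h : ∀ z : ℂ, |z.re - a| < r → 0 < z.im → z.im < r → (stieltjes μ z).im ≤ K * z.im) :
    a ∉ μ.support := by
  refine notMem_support_of_measureReal_Icc_le (K := 2 * K) hr fun x hx η hη hηr => ?_
  set z : ℂ := ⟨x, η⟩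
  have hz : 0 < z.im := hη
  have h1 := h z hx hz hηr
  have h2 : μ.real (Set.Icc (x - η) (x + η)) * (1 / (2 * η)) ≤ (stieltjes μ z).im := by
    rw [stieltjes_im μ hz, ← smul_eq_mul, ← integral_indicator_const _ measurableSet_Icc]
    refine integral_mono ((integrable_const _).indicator measurableSet_Icc)
      (integrable_im_div μ hz) fun t => ?_
    have hn : ‖(t : ℂ) - z‖ ^ 2 = (t - x) ^ 2 + η ^ 2 := by
      rw [← Complex.normSq_eq_norm_sq, Complex.normSq_apply]
      simp [z]; ring
    simp only [hn]
    change _ ≤ η / _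
    by_cases ht : t ∈ Set.Icc (x - η) (x + η)
    · rw [Set.indicator_of_mem ht, div_le_div_iff₀ (by positivity) (by positivity)]
      have : (t - x) ^ 2 ≤ η ^ 2 := sq_le_sq' (by linarith [ht.1]) (by linarith [ht.2])
      nlinarith
    · rw [Set.indicator_of_notMem ht]
      positivity
  have h3 := h2.trans h1
  rw [mul_one_div, div_le_iff₀ (by positivity)] at h3
  change _ ≤ K * η * (2 * η) at h3
  linarith

lemma stieltjes_ofReal (μ : Measure ℝ) (x : ℝ) :
    stieltjes μ (x : ℂ) = ((stieltjes μ x : ℝ) : ℂ) := by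
  rw [stieltjes_complex, stieltjes_real, ← integral_complex_ofReal]
  simp

lemma tendsto_stieltjes (μ : Measure ℝ) [IsFiniteMeasure μ] {x : ℝ} (hx : x ∉ μ.support) :
    Tendsto (fun z : ℂ => stieltjes μ z) (𝓝 (x : ℂ)) (𝓝 ((stieltjes μ x : ℝ) : ℂ)) := by
  have h : (x : ℂ) ∉ algebraMap ℝ ℂ '' μ.support := by
    rintro ⟨y, hy, hyx⟩
    exact hx (Complex.ofReal_injective hyx ▸ hy)
  rw [← stieltjes_ofReal]
  exact (hasDerivAt_resolventTransform (μ := μ) (x : ℂ) h).continuousAt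

/-- The vertical approach to a real point from the upper half plane. -/
lemma tendsto_ofReal_add_mul_I (x : ℝ) :
    Tendsto (fun η : ℝ => (x : ℂ) + η * Complex.I) (𝓝[>] 0) (𝓝 (x : ℂ)) := by
  have : Continuous fun η : ℝ => (x : ℂ) + η * Complex.I := by fun_prop
  simpa using (this.tendsto 0).mono_left nhdsWithin_le_nhds

lemma stieltjes_im_le {μ : Measure ℝ} [IsProbabilityMeasure μ] {x r : ℝ} (hr : 0 < r)
    (hx : ∀ t ∈ μ.support, r ≤ |t - x|) {z : ℂ} (hzx : z.re = x) (hz : 0 < z.im) :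
    (stieltjes μ z).im ≤ z.im / r ^ 2 := by
  rw [stieltjes_im μ hz]
  have h : ∀ᵐ t : ℝ ∂μ, z.im / ‖(t : ℂ) - z‖ ^ 2 ≤ z.im / r ^ 2 := by
    filter_upwards [Measure.support_mem_ae] with t ht
    have h1 : |t - x| ≤ ‖(t : ℂ) - z‖ := by
      simpa [hzx] using Complex.abs_re_le_norm ((t : ℂ) - z)
    have := (hx t ht).trans h1
    gcongr
  simpa using integral_mono_ae (integrable_im_div μ hz) (integrable_const _) h

/-! ### The subordination function -/

/-- The function `σ(z) = -1 / (c m(z))`, where `m` is the Stieltjes transform of `μ`; its value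
is zero where `m(z) = 0`. -/
def subord {𝕜 : Type} [RCLike 𝕜] (c : ℝ) (μ : Measure ℝ) (z : 𝕜) : 𝕜 :=
  -((c : 𝕜) * stieltjes μ z)⁻¹

/-- The map `s ↦ c s + ∫ s t / (s - t) ν(dt)`, a left inverse of `subord c μ` on the upper half
plane when `μ` is the law associated with `c` and `ν`. -/
def subordInv (c : ℝ) (ν : Measure ℝ) (s : ℂ) : ℂ :=
  c * s + ∫ t : ℝ, s * t / (s - t) ∂ν

/-- The integral `∫ |t / (s - t)|² ν(dt)`. -/
def sqIntegral (ν : Measure ℝ) (s : ℂ) : ℝ :=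
  ∫ t : ℝ, ‖(t : ℂ) / (s - t)‖ ^ 2 ∂ν

lemma norm_div_sub_le {κ : ℝ} (hκ : 0 < κ) {s : ℂ} {t : ℝ} (h : κ ≤ ‖s - t‖) :
    ‖(t : ℂ) / (s - t)‖ ≤ 1 + ‖s‖ / κ := by
  have h0 : s - (t : ℂ) ≠ 0 := norm_pos_iff.1 (hκ.trans_le h)
  have h1 : (t : ℂ) / (s - t) = s / (s - t) - 1 := by
    field_simp
    ring
  rw [h1]
  calc _ ≤ ‖s / (s - t)‖ + ‖(1 : ℂ)‖ := norm_sub_le _ _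
    _ = 1 + ‖s‖ / ‖s - t‖ := by rw [norm_div, norm_one, add_comm]
    _ ≤ 1 + ‖s‖ / κ := by gcongr

section Integrals

variable {ν : Measure ℝ} [IsFiniteMeasure ν] {κ κ' : ℝ} {s σ : ℂ}

lemma integrable_div_sub (hκ : 0 < κ) (h : ∀ᵐ t : ℝ ∂ν, κ ≤ ‖s - t‖) :
    Integrable (fun t : ℝ => (t : ℂ) / (s - t)) ν := by
  refine Integrable.of_bound (C := 1 + ‖s‖ / κ)
    (by fun_prop : Measurable _).aestronglyMeasurable ?_
  filter_upwards [h] with t ht using norm_div_sub_le hκ ht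

lemma integrable_mul_div_sub (hκ : 0 < κ) (h : ∀ᵐ t : ℝ ∂ν, κ ≤ ‖s - t‖) :
    Integrable (fun t : ℝ => s * (t : ℂ) / (s - t)) ν := by
  simpa only [mul_div_assoc] using (integrable_div_sub hκ h).const_mul s

lemma integrable_sq_div_sub (hκ : 0 < κ) (h : ∀ᵐ t : ℝ ∂ν, κ ≤ ‖s - t‖) :
    Integrable (fun t : ℝ => ‖(t : ℂ) / (s - t)‖ ^ 2) ν := by
  refine Integrable.of_bound (C := (1 + ‖s‖ / κ) ^ 2)
    (by fun_prop : Measurable _).aestronglyMeasurable ?_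
  filter_upwards [h] with t ht
  rw [norm_pow, norm_norm]
  gcongr
  exact norm_div_sub_le hκ ht

lemma subordInv_sub_subordInv (c : ℝ) (hκ : 0 < κ) (hκ' : 0 < κ')
    (hσ : ∀ᵐ t : ℝ ∂ν, κ' ≤ ‖σ - t‖) (hs : ∀ᵐ t : ℝ ∂ν, κ ≤ ‖s - t‖) :
    subordInv c ν σ - subordInv c ν s
      = (σ - s) * (c - ∫ t : ℝ, (t : ℂ) / (σ - t) * (t / (s - t)) ∂ν) := by
  have h : (∫ t : ℝ, σ * t / (σ - t) ∂ν) - ∫ t : ℝ, s * t / (s - t) ∂ν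
      = -(σ - s) * ∫ t : ℝ, (t : ℂ) / (σ - t) * (t / (s - t)) ∂ν := by
    rw [← integral_sub (integrable_mul_div_sub hκ' hσ) (integrable_mul_div_sub hκ hs),
      ← integral_const_mul]
    refine integral_congr_ae ?_
    filter_upwards [hσ, hs] with t h1 h2
    have h1' : σ - (t : ℂ) ≠ 0 := norm_pos_iff.1 (hκ'.trans_le h1)
    have h2' : s - (t : ℂ) ≠ 0 := norm_pos_iff.1 (hκ.trans_le h2)
    field_simp
    ring
  simp only [subordInv]
  linear_combination h

lemma norm_integral_mul_le (hκ : 0 < κ) (hκ' : 0 < κ')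
    (hσ : ∀ᵐ t : ℝ ∂ν, κ' ≤ ‖σ - t‖) (hs : ∀ᵐ t : ℝ ∂ν, κ ≤ ‖s - t‖) :
    ‖∫ t : ℝ, (t : ℂ) / (σ - t) * (t / (s - t)) ∂ν‖ ≤ (sqIntegral ν σ + sqIntegral ν s) / 2 := by
  rw [sqIntegral, sqIntegral, ← integral_add (integrable_sq_div_sub hκ' hσ)
    (integrable_sq_div_sub hκ hs), ← integral_div]
  refine norm_integral_le_of_norm_le (((integrable_sq_div_sub hκ' hσ).add
    (integrable_sq_div_sub hκ hs)).div_const 2) (ae_of_all _ fun t => ?_)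
  rw [norm_mul]
  nlinarith [sq_nonneg (‖(t : ℂ) / (σ - t)‖ - ‖(t : ℂ) / (s - t)‖)]

lemma mul_sqIntegral_le (hκ : 0 < κ) (hκ' : 0 < κ') {a : ℝ} (ha : 0 ≤ a)
    (hσ : ∀ᵐ t : ℝ ∂ν, κ' ≤ ‖σ - t‖) (hs : ∀ᵐ t : ℝ ∂ν, κ ≤ ‖s - t‖)
    (h : ∀ᵐ t : ℝ ∂ν, a * ‖s - t‖ ≤ ‖σ - t‖) :
    a ^ 2 * sqIntegral ν σ ≤ sqIntegral ν s := by
  rw [sqIntegral, sqIntegral, ← integral_const_mul]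
  refine integral_mono_ae ((integrable_sq_div_sub hκ' hσ).const_mul _)
    (integrable_sq_div_sub hκ hs) ?_
  filter_upwards [hσ, hs, h] with t h1 h2 h3
  rw [← mul_pow, norm_div, norm_div]
  have h1' := hκ'.trans_le h1
  have h2' := hκ.trans_le h2
  gcongr
  rw [mul_div_assoc', div_le_div_iff₀ h1' h2']
  nlinarith [norm_nonneg (t : ℂ)]

end Integrals

/-- A point at relative distance at most `θ` from `s`, measured in units of the distance from `s`
to the support of `ν`, sees that support at nearly the same distances. -/
lemma norm_sub_bounds {κ θ : ℝ} {s σ : ℂ} {t : ℝ} (hθ : 0 ≤ θ) (hs : κ ≤ ‖s - t‖)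
    (h : ‖σ - s‖ ≤ θ * κ) :
    (1 - θ) * ‖s - t‖ ≤ ‖σ - t‖ ∧ ‖σ - t‖ ≤ (1 + θ) * ‖s - t‖ := by
  have h1 : ‖s - (t : ℂ)‖ ≤ ‖s - σ‖ + ‖σ - t‖ := by
    simpa using norm_add_le (s - σ) (σ - (t : ℂ))
  have h2 : ‖σ - (t : ℂ)‖ ≤ ‖σ - s‖ + ‖s - t‖ := by
    simpa using norm_add_le (σ - s) (s - (t : ℂ))
  rw [norm_sub_rev s σ] at h1
  constructor <;> nlinarith

section Law

variable {c : ℝ} {ν μ : Measure ℝ}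

lemma stieltjes_ne_zero [IsProbabilityMeasure μ] {z : ℂ} (hz : 0 < z.im) : stieltjes μ z ≠ 0 := by
  intro h
  have := stieltjes_im_pos μ hz
  simp [h] at this

lemma subord_complex (c : ℝ) (μ : Measure ℝ) (z : ℂ) :
    subord c μ z = -((c : ℂ) * stieltjes μ z)⁻¹ := rfl

lemma subord_im (c : ℝ) (μ : Measure ℝ) (z : ℂ) :
    (subord c μ z).im = (stieltjes μ z).im / (c * ‖stieltjes μ z‖ ^ 2) := by
  rw [subord_complex, mul_inv, ← Complex.ofReal_inv, Complex.neg_im,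
    Complex.im_ofReal_mul, Complex.inv_im, Complex.normSq_eq_norm_sq]
  field_simp

lemma stieltjes_im_eq (hc : 0 < c) [IsProbabilityMeasure μ] {z : ℂ} (hz : 0 < z.im) :
    (stieltjes μ z).im = (subord c μ z).im / (c * ‖subord c μ z‖ ^ 2) := by
  have h : ‖subord c μ z‖ = (c * ‖stieltjes μ z‖)⁻¹ := by
    simp [subord, abs_of_pos hc]
  have := norm_pos_iff.2 (stieltjes_ne_zero (μ := μ) hz)
  rw [h, subord_im]
  field_simp

lemma subord_im_pos (hc : 0 < c) [IsProbabilityMeasure μ] {z : ℂ} (hz : 0 < z.im) :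
    0 < (subord c μ z).im := by
  have h1 := stieltjes_im_pos μ hz
  have h2 := norm_pos_iff.2 (stieltjes_ne_zero (μ := μ) hz)
  rw [subord_im]
  positivity

lemma subord_im_le_norm (hc : 0 < c) [IsProbabilityMeasure μ] {z : ℂ} (hz : 0 < z.im) (t : ℝ) :
    (subord c μ z).im ≤ ‖subord c μ z - t‖ := by
  rw [norm_sub_rev]
  exact im_le_norm_ofReal_sub (subord_im_pos hc hz) t

lemma IsLimitLaw.subordInv_subord (h : IsLimitLaw c ν μ) (hc : 0 < c) {z : ℂ} (hz : 0 < z.im) :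
    subordInv c ν (subord c μ z) = z := by
  have := h.isProbabilityMeasure
  have hm := stieltjes_ne_zero (μ := μ) hz
  have hc' : (c : ℂ) ≠ 0 := by exact_mod_cast hc.ne'
  have heq := h.equation z hz
  have hinv : (stieltjes μ z)⁻¹ = -z + ∫ t : ℝ, (t : ℂ) / (1 + c * stieltjes μ z * t) ∂ν := by
    rw [← inv_inj, inv_inv, ← heq]
  have hint : ∫ t : ℝ, (t : ℂ) / (1 + c * stieltjes μ z * t) ∂ν
      = ∫ t : ℝ, subord c μ z * t / (subord c μ z - t) ∂ν := by
    refine integral_congr_ae (ae_of_all _ fun t => ?_)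
    have hσ : subord c μ z - t ≠ 0 :=
      norm_pos_iff.1 ((subord_im_pos hc hz).trans_le (subord_im_le_norm hc hz t))
    have hσ0 : subord c μ z ≠ 0 := fun h0 => by
      have := subord_im_pos (μ := μ) hc hz
      simp [h0] at this
    have hcm : (c : ℂ) * stieltjes μ z = -(subord c μ z)⁻¹ := by
      simp [subord]
    simp only [hcm]
    have : (1 : ℂ) + -(subord c μ z)⁻¹ * t = (subord c μ z - t) / subord c μ z := by
      field_simp
      ring
    rw [this, div_div_eq_mul_div, mul_comm]
  have hcσ : (c : ℂ) * subord c μ z = -(stieltjes μ z)⁻¹ := by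
    rw [subord_complex]
    field_simp
  rw [subordInv, ← hint, hcσ, hinv]
  ring

/-- The imaginary part of the equation `z = c σ + ∫ σ t / (σ - t) ν(dt)`. -/
lemma IsLimitLaw.im_eq (h : IsLimitLaw c ν μ) (hc : 0 < c) [IsProbabilityMeasure ν]
    {z : ℂ} (hz : 0 < z.im) :
    z.im = (subord c μ z).im * (c - sqIntegral ν (subord c μ z)) := by
  have := h.isProbabilityMeasure
  set σ := subord c μ z with hσ
  have hpos : 0 < σ.im := subord_im_pos hc hz
  have h1 : ∀ᵐ t : ℝ ∂ν, σ.im ≤ ‖σ - t‖ := ae_of_all _ fun t => subord_im_le_norm hc hz t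
  have hint := Complex.imCLM.integral_comp_comm (integrable_mul_div_sub hpos h1)
  simp only [Complex.imCLM_apply] at hint
  have hz' : (subordInv c ν σ).im = z.im := by rw [hσ, h.subordInv_subord hc hz]
  rw [← hz', subordInv, Complex.add_im, Complex.im_ofReal_mul, ← hint, mul_sub, sqIntegral,
    ← integral_const_mul, mul_comm, sub_eq_add_neg, ← integral_neg]
  congr 1
  refine integral_congr_ae (ae_of_all _ fun t => ?_)
  have hne : σ - t ≠ 0 := norm_pos_iff.1 (hpos.trans_le (subord_im_le_norm hc hz t))
  have hn : ‖σ - t‖ ≠ 0 := norm_ne_zero_iff.2 hne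
  have hn2 : Complex.normSq (σ - t) = ‖σ - t‖ ^ 2 := Complex.normSq_eq_norm_sq _
  simp only [norm_div, Complex.div_im, hn2]
  simp
  field_simp
  rw [sq_abs]
  ring

lemma IsLimitLaw.sqIntegral_le (h : IsLimitLaw c ν μ) (hc : 0 < c) [IsProbabilityMeasure ν]
    {z : ℂ} (hz : 0 < z.im) : sqIntegral ν (subord c μ z) ≤ c := by
  have := h.isProbabilityMeasure
  have h1 := h.im_eq hc hz
  have h2 := subord_im_pos (μ := μ) hc hz
  by_contra! h3
  nlinarith

/-- Global stability: wherever `∫ (t / (s - t))² ν(dt) < c`, the value `σ(z)` is within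
`O(|z - Z(s)|)` of `s`, for every `z` in the upper half plane, `Z` being the left inverse of `σ`.
The other factor in the difference identity for `Z` is bounded below because
`∫ |t / (σ(z) - t)|² ν(dt) ≤ c`. -/
lemma IsLimitLaw.norm_subord_sub_le (h : IsLimitLaw c ν μ) (hc : 0 < c) [IsProbabilityMeasure ν]
    {z : ℂ} (hz : 0 < z.im) {κ δ : ℝ} {s : ℂ} (hκ : 0 < κ) (hs : ∀ᵐ t : ℝ ∂ν, κ ≤ ‖s - t‖)
    (hδ : sqIntegral ν s ≤ c - 2 * δ) :
    δ * ‖subord c μ z - s‖ ≤ ‖z - subordInv c ν s‖ := by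
  have := h.isProbabilityMeasure
  have hpos := subord_im_pos (μ := μ) hc hz
  have h1 : ∀ᵐ t : ℝ ∂ν, (subord c μ z).im ≤ ‖subord c μ z - t‖ :=
    ae_of_all _ fun t => subord_im_le_norm hc hz t
  have h2 := subordInv_sub_subordInv c hκ hpos h1 hs
  have h3 := norm_integral_mul_le hκ hpos h1 hs
  have h4 := h.sqIntegral_le hc hz
  rw [h.subordInv_subord hc hz] at h2
  rw [h2, norm_mul, mul_comm]
  gcongr
  have h5 := norm_sub_norm_le (c : ℂ)
    (∫ t : ℝ, (t : ℂ) / (subord c μ z - t) * (t / (s - t)) ∂ν)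
  rw [Complex.norm_real, Real.norm_eq_abs, abs_of_pos hc] at h5
  linarith

end Law

/-! ### The half-line to the right of the support -/

section RightOfSupport

variable {μ : Measure ℝ} {x y : ℝ}

lemma lt_of_mem_rightOfSupport (hx : x ∈ rightOfSupport μ) {t : ℝ} (ht : t ∈ μ.support) :
    t < x :=
  EReal.coe_lt_coe_iff.1 ((le_iSup₂ (f := fun t (_ : t ∈ μ.support) => (t : EReal)) t ht).trans_lt
    hx)

lemma notMem_support_of_mem_rightOfSupport (hx : x ∈ rightOfSupport μ) : x ∉ μ.support :=
  fun h => lt_irrefl x (lt_of_mem_rightOfSupport hx h)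

lemma rightOfSupport_of_le (hx : x ∈ rightOfSupport μ) (hxy : x ≤ y) : y ∈ rightOfSupport μ :=
  lt_of_lt_of_le hx (EReal.coe_le_coe_iff.2 hxy)

lemma exists_lt_mem_rightOfSupport (hx : x ∈ rightOfSupport μ) :
    ∃ y ∈ rightOfSupport μ, y < x := by
  obtain ⟨y, h1, h2⟩ := EReal.lt_iff_exists_real_btwn.1 hx
  exact ⟨y, h1, EReal.coe_lt_coe_iff.1 h2⟩

lemma exists_gap_of_mem_rightOfSupport (hx : x ∈ rightOfSupport μ) :
    ∃ r > 0, ∀ t ∈ μ.support, r ≤ |t - x| := by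
  obtain ⟨y, hy, hyx⟩ := exists_lt_mem_rightOfSupport hx
  refine ⟨x - y, sub_pos.2 hyx, fun t ht => ?_⟩
  have := lt_of_mem_rightOfSupport hy ht
  rw [abs_sub_comm]
  exact le_trans (by linarith) (le_abs_self _)

lemma integral_pos_of_ae_pos [IsProbabilityMeasure μ] {f : ℝ → ℝ} (hf : Integrable f μ)
    (hpos : ∀ᵐ t ∂μ, 0 < f t) : 0 < ∫ t, f t ∂μ := by
  have h0 : 0 ≤ᵐ[μ] f := hpos.mono fun t ht => ht.le
  refine lt_of_le_of_ne (integral_nonneg_of_ae h0) fun h => ?_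
  have h1 := (integral_eq_zero_iff_of_nonneg_ae h0 hf).1 h.symm
  obtain ⟨t, ht, ht'⟩ := (hpos.and h1).exists
  exact ht.ne' ht'

lemma integrable_inv_sub [IsProbabilityMeasure μ] {r : ℝ} (hr : 0 < r)
    (hx : ∀ᵐ t ∂μ, r ≤ |t - x|) : Integrable (fun t => (t - x)⁻¹) μ := by
  refine Integrable.of_bound (C := r⁻¹) (by fun_prop : Measurable _).aestronglyMeasurable ?_
  filter_upwards [hx] with t ht
  rw [norm_inv, Real.norm_eq_abs]
  exact inv_anti₀ hr ht

lemma integrable_inv_sub_of_mem_rightOfSupport [IsProbabilityMeasure μ]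
    (hx : x ∈ rightOfSupport μ) : Integrable (fun t => (t - x)⁻¹) μ := by
  obtain ⟨r, hr, h⟩ := exists_gap_of_mem_rightOfSupport hx
  exact integrable_inv_sub hr (Filter.mem_of_superset Measure.support_mem_ae h)

variable [IsProbabilityMeasure μ]

lemma stieltjes_neg (hx : x ∈ rightOfSupport μ) : stieltjes μ x < 0 := by
  have h := integral_pos_of_ae_pos (integrable_inv_sub_of_mem_rightOfSupport hx).neg (by
    filter_upwards [Measure.support_mem_ae] with t ht
    simpa using lt_of_mem_rightOfSupport hx ht)
  simp only [Pi.neg_apply, integral_neg] at h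
  rw [stieltjes_real]
  linarith

lemma stieltjes_strictMonoOn : StrictMonoOn (fun x : ℝ => stieltjes μ x) (rightOfSupport μ) := by
  intro x hx y hy hxy
  have h := integral_pos_of_ae_pos ((integrable_inv_sub_of_mem_rightOfSupport hy).sub
    (integrable_inv_sub_of_mem_rightOfSupport hx)) (by
    filter_upwards [Measure.support_mem_ae] with t ht
    have h1 := lt_of_mem_rightOfSupport hx ht
    simp only [Pi.sub_apply, sub_pos]
    exact (inv_lt_inv_of_neg (by linarith) (by linarith)).2 (by linarith))
  simp only [Pi.sub_apply] at h
  rw [integral_sub (integrable_inv_sub_of_mem_rightOfSupport hy)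
    (integrable_inv_sub_of_mem_rightOfSupport hx)] at h
  simp only [stieltjes_real]
  linarith

lemma stieltjes_continuousOn : ContinuousOn (fun x : ℝ => stieltjes μ x) (rightOfSupport μ) := by
  intro x hx
  have h : x ∉ algebraMap ℝ ℝ '' μ.support := by
    simpa using notMem_support_of_mem_rightOfSupport hx
  exact (hasDerivAt_resolventTransform (μ := μ) x h).continuousAt.continuousWithinAt

lemma neg_stieltjes_le (hx : x ∈ rightOfSupport μ) (hxy : x < y) :
    -stieltjes μ y ≤ (y - x)⁻¹ := by
  have hy := rightOfSupport_of_le hx hxy.le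
  rw [stieltjes_real, ← integral_neg]
  have : ∀ᵐ t ∂μ, -(t - y)⁻¹ ≤ (y - x)⁻¹ := by
    filter_upwards [Measure.support_mem_ae] with t ht
    have := lt_of_mem_rightOfSupport hx ht
    rw [← inv_neg]
    exact inv_anti₀ (by linarith) (by linarith)
  simpa using integral_mono_ae (integrable_inv_sub_of_mem_rightOfSupport hy).neg
    (integrable_const _) this

variable {c : ℝ}

lemma subord_real (c : ℝ) (μ : Measure ℝ) (x : ℝ) :
    subord c μ x = -(c * stieltjes μ x)⁻¹ := rfl

lemma subord_pos (hc : 0 < c) (hx : x ∈ rightOfSupport μ) : 0 < subord c μ x := by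
  rw [subord_real, ← inv_neg, inv_pos]
  nlinarith [stieltjes_neg hx]

lemma subord_strictMonoOn (hc : 0 < c) :
    StrictMonoOn (fun x : ℝ => subord c μ x) (rightOfSupport μ) := by
  intro x hx y hy hxy
  have h := stieltjes_strictMonoOn hx hy hxy
  have h2 := stieltjes_neg hy
  simp only [subord_real, ← inv_neg]
  exact inv_strictAnti₀ (by nlinarith) (by nlinarith)

lemma subord_continuousOn (hc : 0 < c) :
    ContinuousOn (fun x : ℝ => subord c μ x) (rightOfSupport μ) := by
  simp only [subord_real]
  refine ((continuousOn_const.mul stieltjes_continuousOn).inv₀ fun x hx => ?_).neg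
  exact mul_ne_zero hc.ne' (stieltjes_neg hx).ne

lemma le_subord (hc : 0 < c) (hx : x ∈ rightOfSupport μ) (hxy : x < y) :
    (y - x) / c ≤ subord c μ y := by
  have h := neg_stieltjes_le hx hxy
  have h2 := stieltjes_neg (rightOfSupport_of_le hx hxy.le)
  have h3 : 0 < y - x := sub_pos.2 hxy
  rw [subord_real, ← inv_neg, ← inv_inv ((y - x) / c), inv_div]
  refine inv_anti₀ (by nlinarith) ?_
  calc -(c * stieltjes μ y) = c * -stieltjes μ y := by ring
    _ ≤ c * (y - x)⁻¹ := by gcongr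
    _ = c / (y - x) := by rw [div_eq_mul_inv]

lemma tendsto_subord (hc : 0 < c) (hx : x ∉ μ.support) (hm : stieltjes μ x ≠ 0) :
    Tendsto (fun η : ℝ => subord c μ ((x : ℂ) + η * Complex.I)) (𝓝[>] 0)
      (𝓝 ((subord c μ x : ℝ) : ℂ)) := by
  have h := (tendsto_stieltjes μ hx).comp (tendsto_ofReal_add_mul_I x)
  have h2 := ((h.const_mul (c : ℂ)).inv₀ (by
    exact_mod_cast mul_ne_zero hc.ne' hm)).neg
  rw [subord_real]
  push_cast
  exact h2

end RightOfSupport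

lemma im_ofReal_add_mul_I (x η : ℝ) : ((x : ℂ) + η * Complex.I).im = η := by simp

lemma norm_ofReal_sub_ofReal {s t κ : ℝ} (h : κ ≤ s - t) : κ ≤ ‖(s : ℂ) - t‖ := by
  rw [← Complex.ofReal_sub, Complex.norm_real]
  exact h.trans (le_abs_self _)

namespace IsLimitLaw

variable {c : ℝ} {ν μ : Measure ℝ} {x : ℝ}

/-- This is the bound `∫ |t / (σ(z) - t)|² ν(dt) ≤ c` at a point `z` above `x` which is so close to
`x` that `|σ(z) - σ(x)| < r`; the integrand is then at least `(a / (2 r))²` on the interval. -/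
lemma measureReal_Icc_le (h : IsLimitLaw c ν μ) (hc : 0 < c) [IsProbabilityMeasure ν]
    (hx : x ∈ rightOfSupport μ) {a r : ℝ} (ha : 0 < a) (hr : 0 < r)
    (har : a ≤ subord c μ x - r) :
    ν.real (Set.Icc (subord c μ x - r) (subord c μ x + r)) ≤ 4 * c / a ^ 2 * r ^ 2 := by
  have := h.isProbabilityMeasure
  set s := subord c μ x
  have ht := tendsto_subord hc (notMem_support_of_mem_rightOfSupport hx) (stieltjes_neg hx).ne
  obtain ⟨η, hη, hηpos⟩ := ((ht.eventually (Metric.ball_mem_nhds _ hr)).and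
    self_mem_nhdsWithin).exists
  set z : ℂ := (x : ℂ) + η * Complex.I with hzdef
  have hz : 0 < z.im := by rw [hzdef, im_ofReal_add_mul_I]; exact hηpos
  have hpos := subord_im_pos (μ := μ) hc hz
  have h1 := h.sqIntegral_le hc hz
  set σ : ℂ := subord c μ z
  have hσ : ‖σ - s‖ < r := by simpa [dist_eq_norm] using hη
  have h2 : ν.real (Set.Icc (s - r) (s + r)) * (a / (2 * r)) ^ 2 ≤ sqIntegral ν σ := by
    rw [sqIntegral, ← smul_eq_mul, ← integral_indicator_const _ measurableSet_Icc]
    refine integral_mono ((integrable_const _).indicator measurableSet_Icc)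
      (integrable_sq_div_sub hpos (ae_of_all _ fun t => subord_im_le_norm hc hz t)) fun t => ?_
    by_cases ht : t ∈ Set.Icc (s - r) (s + r)
    · rw [Set.indicator_of_mem ht]
      have h3 : ‖σ - (t : ℂ)‖ ≤ 2 * r := by
        have h4 : ‖σ - (t : ℂ)‖ ≤ ‖σ - s‖ + ‖(s : ℂ) - t‖ := by
          simpa using norm_add_le (σ - s) ((s : ℂ) - (t : ℂ))
        have h5 : ‖(s : ℂ) - t‖ ≤ r := by
          rw [← Complex.ofReal_sub, Complex.norm_real, Real.norm_eq_abs, abs_le]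
          exact ⟨by linarith [ht.2], by linarith [ht.1]⟩
        linarith
      have h6 : 0 < ‖σ - (t : ℂ)‖ := hpos.trans_le (subord_im_le_norm hc hz t)
      have h7 : a ≤ ‖(t : ℂ)‖ := by
        rw [Complex.norm_real]
        exact (har.trans ht.1).trans (le_abs_self _)
      simp only [norm_div]
      gcongr
    · rw [Set.indicator_of_notMem ht]
      positivity
  have h3 := h2.trans h1
  rw [div_mul_eq_mul_div, le_div_iff₀ (by positivity)]
  have h4 : ν.real (Set.Icc (s - r) (s + r)) * a ^ 2
      = ν.real (Set.Icc (s - r) (s + r)) * (a / (2 * r)) ^ 2 * (4 * r ^ 2) := by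
    field_simp
    norm_num
  rw [h4]
  nlinarith [sq_nonneg r]

/-- To the right of the support of `μ`, the subordination function avoids the support of `ν`:
it sweeps out a neighbourhood of each of its values, and near each of these `ν` has
quadratically small mass. -/
lemma subord_notMem_support (h : IsLimitLaw c ν μ) (hc : 0 < c) [IsProbabilityMeasure ν]
    (hx : x ∈ rightOfSupport μ) : subord c μ x ∉ ν.support := by
  have := h.isProbabilityMeasure
  obtain ⟨y, hy, hyx⟩ := exists_lt_mem_rightOfSupport hx
  have hx' : x + 1 ∈ rightOfSupport μ := rightOfSupport_of_le hx (by linarith)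
  have h1 := subord_strictMonoOn hc hy hx hyx
  have h2 := subord_strictMonoOn hc hx hx' (by linarith)
  have hpos := subord_pos hc hx
  simp only at h1 h2
  set ε := min (subord c μ x / 4) (min (subord c μ x - subord c μ y)
    (subord c μ (x + 1) - subord c μ x)) with hε
  have e1 : ε ≤ subord c μ x / 4 := min_le_left _ _
  have e2 : ε ≤ subord c μ x - subord c μ y := (min_le_right _ _).trans (min_le_left _ _)
  have e3 : ε ≤ subord c μ (x + 1) - subord c μ x := (min_le_right _ _).trans (min_le_right _ _)
  have hεpos : 0 < ε := lt_min (by linarith) (lt_min (by linarith) (by linarith))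
  refine notMem_support_of_measureReal_Icc_le (K := 4 * c / (subord c μ x / 2) ^ 2) hεpos ?_
  intro s hs r hr hrε
  rw [abs_lt] at hs
  have hsub : Set.Icc y (x + 1) ⊆ rightOfSupport μ := fun w hw => rightOfSupport_of_le hy hw.1
  obtain ⟨w, hw, rfl⟩ := intermediate_value_Icc (by linarith) ((subord_continuousOn hc).mono hsub)
    (show s ∈ Set.Icc (subord c μ y) (subord c μ (x + 1)) from ⟨by linarith, by linarith⟩)
  exact h.measureReal_Icc_le hc (hsub hw) (by linarith) hr (by linarith)

/-- The subordination function maps the right of the support of `μ` to the right of the support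
of `ν`: it avoids the maximum of that support, and it tends to infinity. -/
lemma lt_subord (h : IsLimitLaw c ν μ) (hc : 0 < c) [IsProbabilityMeasure ν]
    (hν : IsCompact ν.support) (hx : x ∈ rightOfSupport μ) {t : ℝ} (ht : t ∈ ν.support) :
    t < subord c μ x := by
  have := h.isProbabilityMeasure
  obtain ⟨b, hb, hmax⟩ := hν.exists_isMaxOn ⟨t, ht⟩ continuousOn_id
  refine (hmax ht : t ≤ b).trans_lt ?_
  by_contra! hle
  have hy : x < x + (1 + c * |b|) := by nlinarith [abs_nonneg b]
  set y := x + (1 + c * |b|) with hydef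
  have hby : b ≤ subord c μ y := by
    refine le_trans ?_ (le_subord hc hx hy)
    rw [hydef, add_sub_cancel_left, le_div_iff₀ hc]
    nlinarith [le_abs_self b]
  have hsub : Set.Icc x y ⊆ rightOfSupport μ := fun w hw => rightOfSupport_of_le hx hw.1
  obtain ⟨w, hw, hwb⟩ := intermediate_value_Icc hy.le ((subord_continuousOn hc).mono hsub)
    (show b ∈ Set.Icc (subord c μ x) (subord c μ y) from ⟨hle, hby⟩)
  exact h.subord_notMem_support hc (hsub hw)
    (by rwa [show subord c μ w = b from hwb])

lemma exists_gap_subord (h : IsLimitLaw c ν μ) (hc : 0 < c) [IsProbabilityMeasure ν]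
    (hν : IsCompact ν.support) (hx : x ∈ rightOfSupport μ) :
    ∃ κ > 0, ∀ t ∈ ν.support, κ ≤ subord c μ x - t := by
  obtain ⟨b, hb, hmax⟩ := hν.exists_isMaxOn
    (Measure.nonempty_support (IsProbabilityMeasure.ne_zero ν)) continuousOn_id
  refine ⟨subord c μ x - b, sub_pos.2 (h.lt_subord hc hν hx hb), fun t ht => ?_⟩
  have : t ≤ b := hmax ht
  linarith

/-- The equation of the law, at a real point to the right of the support. -/
lemma subordInv_subord_of_mem_rightOfSupport (h : IsLimitLaw c ν μ) (hc : 0 < c)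
    [IsProbabilityMeasure ν] (hx : x ∈ rightOfSupport μ) {κ : ℝ} (hκ : 0 < κ)
    (hgap : ∀ᵐ t ∂ν, κ ≤ subord c μ x - t) :
    subordInv c ν (subord c μ x : ℝ) = x := by
  have := h.isProbabilityMeasure
  set s := subord c μ x with hs
  have hgap' : ∀ᵐ t : ℝ ∂ν, κ ≤ ‖(s : ℂ) - t‖ := hgap.mono fun t => norm_ofReal_sub_ofReal
  have ht := tendsto_subord hc (notMem_support_of_mem_rightOfSupport hx) (stieltjes_neg hx).ne
  rw [← hs] at ht
  have hlim : Tendsto (fun η : ℝ => ‖subord c μ ((x : ℂ) + η * Complex.I) - s‖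
      * (c + (c + sqIntegral ν s) / 2)) (𝓝[>] 0) (𝓝 0) := by
    simpa using (ht.sub_const (s : ℂ)).norm.mul_const (c + (c + sqIntegral ν s) / 2)
  have hlim2 : Tendsto (fun η : ℝ => ‖(x : ℂ) + η * Complex.I - subordInv c ν s‖) (𝓝[>] 0)
      (𝓝 ‖(x : ℂ) - subordInv c ν s‖) := ((tendsto_ofReal_add_mul_I x).sub_const _).norm
  have hle : ‖(x : ℂ) - subordInv c ν s‖ ≤ 0 := by
    refine le_of_tendsto_of_tendsto hlim2 hlim ?_
    filter_upwards [self_mem_nhdsWithin] with η hη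
    set z : ℂ := (x : ℂ) + η * Complex.I with hzdef
    have hz : 0 < z.im := by rw [hzdef, im_ofReal_add_mul_I]; exact hη
    have hpos := subord_im_pos (μ := μ) hc hz
    have h1 : ∀ᵐ t : ℝ ∂ν, (subord c μ z).im ≤ ‖subord c μ z - t‖ :=
      ae_of_all _ fun t => subord_im_le_norm hc hz t
    have h2 := subordInv_sub_subordInv c hκ hpos h1 hgap'
    have h3 := norm_integral_mul_le hκ hpos h1 hgap'
    have h4 := h.sqIntegral_le hc hz
    rw [h.subordInv_subord hc hz] at h2
    rw [h2, norm_mul]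
    gcongr
    refine (norm_sub_le _ _).trans ?_
    rw [Complex.norm_real, Real.norm_eq_abs, abs_of_pos hc]
    linarith
  exact (sub_eq_zero.1 (norm_le_zero_iff.1 hle)).symm

/-- The strict inequality `∫ (t / (s - t))² ν(dt) < c` at `s = σ(x)`, which says that the derivative
of the left inverse of `σ` is positive there. Along `z = x + iη` the difference of the two sides
is `η / Im σ(z)`, which is bounded below because `Im m(z) = O(η)` off the support of `μ`. -/
lemma sqIntegral_subord_lt (h : IsLimitLaw c ν μ) (hc : 0 < c)
    [IsProbabilityMeasure ν] (hx : x ∈ rightOfSupport μ) {κ : ℝ} (hκ : 0 < κ)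
    (hgap : ∀ᵐ t ∂ν, κ ≤ subord c μ x - t) :
    sqIntegral ν (subord c μ x : ℝ) < c := by
  have := h.isProbabilityMeasure
  have hmne := (stieltjes_neg hx).ne
  set s := subord c μ x with hs
  have hgap' : ∀ᵐ t : ℝ ∂ν, κ ≤ ‖(s : ℂ) - t‖ := hgap.mono fun t => norm_ofReal_sub_ofReal
  obtain ⟨r, hr, hxr⟩ := exists_gap_of_mem_rightOfSupport hx
  have hx' := notMem_support_of_mem_rightOfSupport hx
  have ht := tendsto_subord hc hx' hmne
  have hm := (tendsto_stieltjes μ hx').comp (tendsto_ofReal_add_mul_I x)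
  have hlim1 : Tendsto (fun η : ℝ =>
      ((1 + ‖subord c μ ((x : ℂ) + η * Complex.I) - s‖ / κ)⁻¹) ^ 2 * sqIntegral ν s) (𝓝[>] 0)
      (𝓝 (sqIntegral ν s)) := by
    have h1 := (((ht.sub_const (s : ℂ)).norm.div_const κ).const_add 1)
    rw [sub_self, norm_zero, zero_div, add_zero] at h1
    simpa using ((h1.inv₀ one_ne_zero).pow 2).mul_const (sqIntegral ν s)
  have hlim2 : Tendsto (fun η : ℝ => c - r ^ 2 * c * ‖stieltjes μ ((x : ℂ) + η * Complex.I)‖ ^ 2)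
      (𝓝[>] 0) (𝓝 (c - r ^ 2 * c * ‖((stieltjes μ x : ℝ) : ℂ)‖ ^ 2)) :=
    ((hm.norm.pow 2).const_mul _).const_sub _
  have hle := le_of_tendsto_of_tendsto hlim1 hlim2 (by
    filter_upwards [self_mem_nhdsWithin] with η hη
    set z : ℂ := (x : ℂ) + η * Complex.I with hzdef
    have hz : 0 < z.im := by rw [hzdef, im_ofReal_add_mul_I]; exact hη
    have hzre : z.re = x := by simp [hzdef]
    have hpos := subord_im_pos (μ := μ) hc hz
    have h1 : ∀ᵐ t : ℝ ∂ν, (subord c μ z).im ≤ ‖subord c μ z - t‖ :=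
      ae_of_all _ fun t => subord_im_le_norm hc hz t
    have hm0 := norm_pos_iff.2 (stieltjes_ne_zero (μ := μ) hz)
    have h2 := h.im_eq hc hz
    have h3 := stieltjes_im_le hr hxr hzre hz
    have h4 := subord_im c μ z
    refine (mul_sqIntegral_le hpos hκ (by positivity) hgap' h1 ?_).trans ?_
    · filter_upwards [hgap'] with t ht
      rw [inv_mul_le_iff₀ (by positivity)]
      refine (norm_sub_bounds (θ := ‖subord c μ z - s‖ / κ) (by positivity) ht ?_).2
      rw [div_mul_cancel₀ _ hκ.ne']
    · set S := sqIntegral ν (subord c μ z)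
      have h5 : (stieltjes μ z).im = (subord c μ z).im * (c * ‖stieltjes μ z‖ ^ 2) := by
        rw [h4]
        field_simp
      rw [le_div_iff₀ (by positivity), h5, h2] at h3
      have h6 : c * ‖stieltjes μ z‖ ^ 2 * r ^ 2 ≤ c - S :=
        le_of_mul_le_mul_left (by linarith) hpos
      linarith)
  have : 0 < r ^ 2 * c * ‖((stieltjes μ x : ℝ) : ℂ)‖ ^ 2 := by
    have : 0 < ‖((stieltjes μ x : ℝ) : ℂ)‖ := norm_pos_iff.2 (by exact_mod_cast hmne)
    positivity
  linarith

end IsLimitLaw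

/-! ### The function `g` and the limiting outliers -/

lemma subordInv_ofReal (c : ℝ) {ν : Measure ℝ} [IsProbabilityMeasure ν] {s κ : ℝ} (hκ : 0 < κ)
    (hgap : ∀ᵐ t ∂ν, κ ≤ s - t) :
    subordInv c ν (s : ℂ) = ((c * s - s - s ^ 2 * stieltjes ν s : ℝ) : ℂ) := by
  have hint : Integrable (fun t => (t - s)⁻¹) ν := integrable_inv_sub hκ (by
    filter_upwards [hgap] with t ht
    rw [abs_sub_comm]
    exact ht.trans (le_abs_self _))
  have h : ∫ t : ℝ, (s : ℂ) * t / (s - t) ∂ν = ((-s - s ^ 2 * stieltjes ν s : ℝ) : ℂ) := by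
    have h1 : -s - s ^ 2 * stieltjes ν s = ∫ t, (-s - s ^ 2 * (t - s)⁻¹) ∂ν := by
      rw [integral_sub (integrable_const _) (hint.const_mul _), integral_const_mul, stieltjes_real]
      simp
    rw [h1, ← integral_complex_ofReal]
    refine integral_congr_ae ?_
    filter_upwards [hgap] with t ht
    have h2 : (s : ℂ) - t ≠ 0 := by
      rw [← Complex.ofReal_sub]
      exact_mod_cast (hκ.trans_le ht).ne'
    have h3 : (t : ℂ) - s ≠ 0 := by
      rw [← neg_sub]
      exact neg_ne_zero.2 h2
    push_cast
    field_simp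
    ring
  rw [subordInv, h]
  push_cast
  ring

lemma mem_rightOfSupport_of_gap {ν : Measure ℝ} {s κ : ℝ} (hκ : 0 < κ)
    (hgap : ∀ t ∈ ν.support, κ ≤ s - t) : s ∈ rightOfSupport ν := by
  refine lt_of_le_of_lt (iSup₂_le (a := ((s - κ : ℝ) : EReal)) fun t ht => ?_) ?_
  · exact EReal.coe_le_coe_iff.2 (by linarith [hgap t ht])
  · exact EReal.coe_lt_coe_iff.2 (by linarith)

namespace IsLimitLaw

variable {c : ℝ} {ν μ : Measure ℝ} {x : ℝ}

lemma subord_mem_rightOfSupport (h : IsLimitLaw c ν μ) (hc : 0 < c) [IsProbabilityMeasure ν]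
    (hν : IsCompact ν.support) (hx : x ∈ rightOfSupport μ) :
    subord c μ x ∈ rightOfSupport ν := by
  obtain ⟨κ, hκ, hgap⟩ := h.exists_gap_subord hc hν hx
  exact mem_rightOfSupport_of_gap hκ hgap

lemma g_eq (h : IsLimitLaw c ν μ) (hc : 0 < c) [IsProbabilityMeasure ν]
    (hν : IsCompact ν.support) (hx : x ∈ rightOfSupport μ) :
    g c μ x = -stieltjes ν (subord c μ x) / c := by
  have := h.isProbabilityMeasure
  obtain ⟨κ, hκ, hgap⟩ := h.exists_gap_subord hc hν hx
  have hgap' := Filter.mem_of_superset Measure.support_mem_ae hgap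
  have h1 := h.subordInv_subord_of_mem_rightOfSupport hc hx hκ hgap'
  rw [subordInv_ofReal c hκ hgap', Complex.ofReal_inj] at h1
  have hs := subord_pos hc hx
  have hm : stieltjes μ x = -(c * subord c μ x)⁻¹ := by
    rw [subord_real, mul_neg, inv_neg, neg_neg, mul_inv, inv_inv]
    field_simp
  rw [g, hm]
  set s := subord c μ x
  rw [← h1]
  field_simp
  ring

lemma g_strictAntiOn (h : IsLimitLaw c ν μ) (hc : 0 < c) [IsProbabilityMeasure ν]
    (hν : IsCompact ν.support) : StrictAntiOn (g c μ) (rightOfSupport μ) := by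
  have := h.isProbabilityMeasure
  intro x hx y hy hxy
  rw [h.g_eq hc hν hx, h.g_eq hc hν hy]
  have := stieltjes_strictMonoOn (h.subord_mem_rightOfSupport hc hν hx)
    (h.subord_mem_rightOfSupport hc hν hy) (subord_strictMonoOn hc hx hy hxy)
  simp only at this
  gcongr

lemma g_continuousOn (h : IsLimitLaw c ν μ) (hc : 0 < c) [IsProbabilityMeasure ν]
    (hν : IsCompact ν.support) : ContinuousOn (g c μ) (rightOfSupport μ) := by
  have := h.isProbabilityMeasure
  refine ContinuousOn.congr (f := fun x => -stieltjes ν (subord c μ x) / c) ?_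
    fun x hx => h.g_eq hc hν hx
  exact (stieltjes_continuousOn.comp (subord_continuousOn hc)
    fun x hx => h.subord_mem_rightOfSupport hc hν hx).neg.div_const c

/-- On the right of the support, `g` takes every positive value below any of its values, since it
is continuous and tends to zero at infinity. -/
lemma exists_g_eq (h : IsLimitLaw c ν μ) (hc : 0 < c) [IsProbabilityMeasure ν]
    (hν : IsCompact ν.support) (hx : x ∈ rightOfSupport μ) {a : ℝ} (ha : 0 < a)
    (hax : a ≤ g c μ x) : ∃ y ∈ rightOfSupport μ, g c μ y = a := by
  have := h.isProbabilityMeasure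
  set b := subord c μ x with hb
  have hbν := h.subord_mem_rightOfSupport hc hν hx
  have hbpos : 0 < b := subord_pos hc hx
  have hac : 0 < (a * c)⁻¹ := by positivity
  -- `y` is so large that `σ(y) - σ(x) ≥ 1 / (a c)`.
  set y := x + c * (b + (a * c)⁻¹) with hy
  have hxy : x < y := by rw [hy]; linarith [mul_pos hc (add_pos hbpos hac)]
  have hyμ := rightOfSupport_of_le hx hxy.le
  have h1 := le_subord hc hx hxy
  rw [hy, add_sub_cancel_left, mul_div_cancel_left₀ _ hc.ne', ← hy] at h1
  have h2 := neg_stieltjes_le hbν (y := subord c μ y) (by linarith)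
  have h3 : (subord c μ y - b)⁻¹ ≤ a * c := by
    rw [← inv_inv (a * c)]
    exact inv_anti₀ hac (by linarith)
  have hya : g c μ y ≤ a := by
    rw [h.g_eq hc hν hyμ, div_le_iff₀ hc]
    linarith
  have hsub : Set.Icc x y ⊆ rightOfSupport μ := fun w hw => rightOfSupport_of_le hx hw.1
  obtain ⟨w, hw, hwa⟩ := intermediate_value_Icc' hxy.le ((h.g_continuousOn hc hν).mono hsub)
    (show a ∈ Set.Icc (g c μ y) (g c μ x) from ⟨hya, hax⟩)
  exact ⟨w, hsub hw, hwa⟩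

lemma one_add_mul_ne_zero (hc : 0 < c) {s m : ℝ} (hm : m ≠ 0) (hs : s = -(c * m)⁻¹) {t : ℝ}
    (hts : s - t ≠ 0) : 1 + c * m * t ≠ 0 := by
  intro h0
  apply hts
  have hcm : c * m ≠ 0 := mul_ne_zero hc.ne' hm
  rw [hs]
  field_simp
  linarith

lemma Delta_pos (h : IsLimitLaw c ν μ) (hc : 0 < c) [IsProbabilityMeasure ν]
    (hν : IsCompact ν.support) (hx : x ∈ rightOfSupport μ) : 0 < Delta c ν μ x := by
  have := h.isProbabilityMeasure
  obtain ⟨κ, hκ, hgap⟩ := h.exists_gap_subord hc hν hx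
  have hgap' := Filter.mem_of_superset Measure.support_mem_ae hgap
  have h1 := h.sqIntegral_subord_lt hc hx hκ hgap'
  have hm := (stieltjes_neg hx).ne
  have h2 : ∫ t, (stieltjes μ x * t / (1 + c * stieltjes μ x * t)) ^ 2 ∂ν
      = sqIntegral ν (subord c μ x : ℝ) / c ^ 2 := by
    rw [sqIntegral, ← integral_div]
    refine integral_congr_ae ?_
    filter_upwards [hgap'] with t ht
    have hne : subord c μ x - t ≠ 0 := (hκ.trans_le ht).ne'
    have hne' := one_add_mul_ne_zero hc hm (subord_real c μ x) hne
    rw [← Complex.ofReal_sub, ← Complex.ofReal_div, Complex.norm_real, Real.norm_eq_abs, sq_abs,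
      ← div_pow, ← neg_sq]
    congr 1
    have hs : subord c μ x - t = -(1 + c * stieltjes μ x * t) / (c * stieltjes μ x) := by
      rw [subord_real]
      field_simp
      ring
    rw [hs]
    field_simp
  rw [Delta, h2, sub_pos]
  field_simp
  exact h1

end IsLimitLaw

/-- If a strictly decreasing `f` takes all positive values below its values, then for decreasing
weights the equations `ω l * f x = 1` which have a solution are the first ones. -/
lemma exists_decreasing_solutions {S : Set ℝ} {f : ℝ → ℝ} (hf : StrictAntiOn f S)
    (hiv : ∀ x ∈ S, ∀ a, 0 < a → a ≤ f x → ∃ y ∈ S, f y = a)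
    {t : ℕ} (ht : 0 < t) {ω : Fin t → ℝ} (hpos : ∀ l, 0 < ω l) (hω : StrictAnti ω)
    (hsol : ∃ x ∈ S, ω ⟨0, ht⟩ * f x = 1) :
    ∃ (p : ℕ) (hp : p ≤ t) (ρ : Fin p → ℝ), 0 < p ∧ StrictAnti ρ ∧ (∀ i, ρ i ∈ S) ∧
      ∀ x ∈ S, ∀ l : Fin t, ω l * f x = 1 ↔ ∃ i : Fin p, Fin.castLE hp i = l ∧ ρ i = x := by
  classical
  have hval : ∀ l x, ω l * f x = 1 ↔ f x = (ω l)⁻¹ := fun l x => by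
    rw [mul_comm]
    exact mul_eq_one_iff_eq_inv₀ (hpos l).ne'
  have hdown : ∀ k l : Fin t, k ≤ l → (∃ x ∈ S, ω l * f x = 1) → ∃ x ∈ S, ω k * f x = 1 := by
    rintro k l hkl ⟨x, hx, hxl⟩
    rw [hval] at hxl
    obtain ⟨y, hy, hyk⟩ := hiv x hx (ω k)⁻¹ (inv_pos.2 (hpos k))
      (hxl ▸ inv_anti₀ (hpos l) (hω.antitone hkl))
    exact ⟨y, hy, (hval k y).2 hyk⟩
  have hex : ∃ k, ¬∃ hk : k < t, ∃ x ∈ S, ω ⟨k, hk⟩ * f x = 1 := ⟨t, fun ⟨h, _⟩ => lt_irrefl t h⟩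
  set p := Nat.find hex with hpdef
  have hp : p ≤ t := Nat.find_min' hex fun ⟨h, _⟩ => lt_irrefl t h
  have hlt : ∀ k < p, ∃ hk : k < t, ∃ x ∈ S, ω ⟨k, hk⟩ * f x = 1 := fun k hk =>
    not_not.1 (Nat.find_min hex hk)
  have hroot : ∀ i : Fin p, ∃ x ∈ S, ω (Fin.castLE hp i) * f x = 1 := fun i => (hlt i i.2).2
  choose ρ hρS hρ using hroot
  refine ⟨p, hp, ρ, ?_, ?_, hρS, ?_⟩
  · by_contra! h0
    have hp0 : p = 0 := by omega
    have := Nat.find_spec hex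
    rw [← hpdef, hp0] at this
    exact this ⟨ht, hsol⟩
  · intro i k hik
    by_contra! hle
    have h1 := hf.antitoneOn (hρS i) (hρS k) hle
    rw [(hval _ _).1 (hρ i), (hval _ _).1 (hρ k), inv_le_inv₀ (hpos _) (hpos _)] at h1
    exact (hω (show Fin.castLE hp i < Fin.castLE hp k from hik)).not_ge h1
  · intro x hx l
    constructor
    · intro hxl
      have hlp : (l : ℕ) < p := by
        by_contra! hge
        apply Nat.find_spec hex
        rw [← hpdef]
        exact ⟨hge.trans_lt l.2, hdown _ l hge ⟨x, hx, hxl⟩⟩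
      refine ⟨⟨l, hlp⟩, rfl, hf.injOn (hρS _) hx ?_⟩
      rw [(hval _ _).1 (hρ _), (hval _ _).1 hxl]
      rfl
    · rintro ⟨i, rfl, rfl⟩
      exact hρ i

/-! ### Perturbation of the law -/

/-- An outlier is stable under perturbation. If `ρ` is close to `Z(s)`, where `Z` is the left
inverse of the subordination function `σ` and `∫ (t / (s - t))² ν(dt) < c`, then `σ` stays close
to `s` above a neighbourhood of `ρ`, so that its imaginary part is `O(η)` at height `η`. Hence `μ`
has no mass near `ρ`, and the stability bound extends to `ρ`. -/
theorem IsLimitLaw.outlier_stable {c : ℝ} {ν μ : Measure ℝ} (h : IsLimitLaw c ν μ) (hc : 0 < c)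
    [IsProbabilityMeasure ν] {ρ s κ δ θ : ℝ} (hs : 0 < s) (hκ : 0 < κ) (hδ : 0 < δ) (hθ : 0 < θ)
    (hθ1 : θ ≤ 1 / 2) (hcθ : 4 * c * θ ≤ δ) (hθs : θ * κ ≤ s / 2)
    (hgap : ∀ᵐ t ∂ν, κ ≤ s - t) (hS : sqIntegral ν (s : ℂ) ≤ c - 2 * δ)
    (hρ : ‖(ρ : ℂ) - subordInv c ν s‖ ≤ δ * (θ * κ) / 2) :
    ρ ∉ μ.support ∧ stieltjes μ ρ ≠ 0 ∧
      δ * |subord c μ ρ - s| ≤ ‖(ρ : ℂ) - subordInv c ν s‖ := by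
  have := h.isProbabilityMeasure
  have hgap' : ∀ᵐ t : ℝ ∂ν, κ ≤ ‖(s : ℂ) - t‖ := hgap.mono fun t => norm_ofReal_sub_ofReal
  have hr : 0 < δ * (θ * κ) / 4 := by positivity
  have hclose : ∀ z : ℂ, |z.re - ρ| < δ * (θ * κ) / 4 → 0 < z.im → z.im < δ * (θ * κ) / 4 →
      ‖subord c μ z - s‖ ≤ θ * κ := by
    intro z hzre hz hzim
    have h1 := h.norm_subord_sub_le hc hz hκ hgap' hS
    have h2 : ‖z - ρ‖ ≤ |z.re - ρ| + |z.im| := by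
      simpa using Complex.norm_le_abs_re_add_abs_im (z - ρ)
    have h3 : ‖z - subordInv c ν s‖ ≤ ‖z - ρ‖ + ‖(ρ : ℂ) - subordInv c ν s‖ := by
      simpa using norm_add_le (z - ρ) ((ρ : ℂ) - subordInv c ν s)
    rw [abs_of_pos hz] at h2
    exact le_of_mul_le_mul_left (by linarith) hδ
  have hnorm : ∀ z : ℂ, ‖subord c μ z - s‖ ≤ θ * κ →
      s / 2 ≤ ‖subord c μ z‖ ∧ ‖subord c μ z‖ ≤ 2 * s := by
    intro z hz
    have h1 : ‖(s : ℂ)‖ = s := by rw [Complex.norm_real, Real.norm_eq_abs, abs_of_pos hs]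
    have h2 := norm_sub_norm_le (s : ℂ) (subord c μ z)
    have h3 := norm_sub_norm_le (subord c μ z) (s : ℂ)
    rw [norm_sub_rev] at h2
    constructor <;> linarith
  have hsupp : ρ ∉ μ.support := by
    refine notMem_support_of_stieltjes_im_le (K := 1 / (δ * (c * (s / 2) ^ 2))) hr ?_
    intro z hzre hz hzim
    have h1 := hclose z hzre hz hzim
    have h2 := (hnorm z h1).1
    have hpos := subord_im_pos (μ := μ) hc hz
    have h3 : (1 - θ) ^ 2 * sqIntegral ν (subord c μ z) ≤ sqIntegral ν s := by
      refine mul_sqIntegral_le hκ hpos (by linarith)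
        (ae_of_all _ fun t => subord_im_le_norm hc hz t) hgap' ?_
      filter_upwards [hgap'] with t ht using (norm_sub_bounds hθ.le ht h1).1
    have h4 := h.sqIntegral_le hc hz
    have h5 : 0 ≤ sqIntegral ν (subord c μ z) := integral_nonneg fun t => by positivity
    have h6 : sqIntegral ν (subord c μ z) ≤ c - δ := by nlinarith [sq_nonneg θ]
    have h7 := h.im_eq hc hz
    have h10 : 0 < ‖subord c μ z‖ := by linarith
    have h8 : δ * (subord c μ z).im ≤ z.im := by rw [h7]; nlinarith
    rw [stieltjes_im_eq hc hz, div_mul_eq_mul_div, one_mul,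
      div_le_div_iff₀ (by positivity) (by positivity)]
    have h9 : c * (s / 2) ^ 2 ≤ c * ‖subord c μ z‖ ^ 2 := by gcongr
    calc (subord c μ z).im * (δ * (c * (s / 2) ^ 2))
        = δ * (subord c μ z).im * (c * (s / 2) ^ 2) := by ring
      _ ≤ z.im * (c * ‖subord c μ z‖ ^ 2) := by gcongr
  have hvert : ∀ᶠ η : ℝ in 𝓝[>] 0, 0 < ((ρ : ℂ) + η * Complex.I).im ∧
      ‖subord c μ ((ρ : ℂ) + η * Complex.I) - s‖ ≤ θ * κ := by
    filter_upwards [Ioo_mem_nhdsGT hr] with η hη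
    have him := im_ofReal_add_mul_I ρ η
    have h0 : 0 < ((ρ : ℂ) + η * Complex.I).im := him.symm ▸ hη.1
    exact ⟨h0, hclose _ (by simpa using hr) h0 (him.symm ▸ hη.2)⟩
  have hne : stieltjes μ ρ ≠ 0 := by
    have h1 := ((tendsto_stieltjes μ hsupp).comp (tendsto_ofReal_add_mul_I ρ)).norm
    have h2 : 1 / (c * (2 * s)) ≤ ‖((stieltjes μ ρ : ℝ) : ℂ)‖ := by
      refine ge_of_tendsto h1 ?_
      filter_upwards [hvert] with η hη
      have h3 := (hnorm _ hη.2).2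
      have h4 := norm_pos_iff.2 (stieltjes_ne_zero (μ := μ) hη.1)
      rw [subord_complex, norm_neg, norm_inv, norm_mul, Complex.norm_real, Real.norm_eq_abs,
        abs_of_pos hc, inv_le_iff_one_le_mul₀ (by positivity)] at h3
      rw [Function.comp_apply, div_le_iff₀ (by positivity)]
      linarith
    have h5 : 0 < ‖((stieltjes μ ρ : ℝ) : ℂ)‖ := lt_of_lt_of_le (by positivity) h2
    exact_mod_cast norm_pos_iff.1 h5
  refine ⟨hsupp, hne, ?_⟩
  have h1 := (((tendsto_subord hc hsupp hne).sub_const (s : ℂ)).norm).const_mul δ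
  have h2 := ((tendsto_ofReal_add_mul_I ρ).sub_const (subordInv c ν s)).norm
  have h3 : |subord c μ ρ - s| = ‖((subord c μ ρ : ℝ) : ℂ) - s‖ := by
    rw [← Complex.ofReal_sub, Complex.norm_real, Real.norm_eq_abs]
  rw [h3]
  refine le_of_tendsto_of_tendsto h1 h2 ?_
  filter_upwards [hvert] with η hη using h.norm_subord_sub_le hc hη.1 hκ hgap' hS

/-! ### Empirical measures -/

lemma isProbabilityMeasure_empirical {n : ℕ} (hn : 0 < n) (d : Fin n → ℝ) :
    IsProbabilityMeasure (empirical d) := by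
  constructor
  have : (n : ENNReal) ≠ 0 := by exact_mod_cast hn.ne'
  simp [empirical, ENNReal.inv_mul_cancel this (ENNReal.natCast_ne_top n)]

lemma ae_empirical {n : ℕ} {d : Fin n → ℝ} {p : ℝ → Prop} (h : ∀ k, p (d k)) :
    ∀ᵐ t ∂(empirical d), p t := by
  rw [ae_iff]
  simp [empirical, h]

lemma tendsto_sqIntegral {ν : Measure ℝ} {νn : ℕ → Measure ℝ}
    (hνn : ∀ f : ℝ →ᵇ ℝ, Tendsto (fun n => ∫ x, f x ∂(νn n)) atTop (𝓝 (∫ x, f x ∂ν)))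
    {s κ : ℝ} (hκ : 0 < κ) (hgap : ∀ᵐ t ∂ν, κ ≤ s - t)
    (hgapn : ∀ᶠ n in atTop, ∀ᵐ t ∂(νn n), κ ≤ s - t) :
    Tendsto (fun n => sqIntegral (νn n) s) atTop (𝓝 (sqIntegral ν s)) := by
  -- Off the half-line `(-∞, s - κ]` the integrand is replaced by a constant.
  have hmin : ∀ t : ℝ, κ ≤ ‖(s : ℂ) - (min t (s - κ) : ℝ)‖ := fun t =>
    norm_ofReal_sub_ofReal (by linarith [min_le_right t (s - κ)])
  set f : ℝ →ᵇ ℝ := BoundedContinuousFunction.ofNormedAddCommGroup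
    (fun t : ℝ => ‖((min t (s - κ) : ℝ) : ℂ) / (s - (min t (s - κ) : ℝ))‖ ^ 2)
    (by
      refine ((Continuous.div (by fun_prop) (by fun_prop) fun t => ?_).norm).pow 2
      exact norm_pos_iff.1 (hκ.trans_le (hmin t)))
    ((1 + ‖(s : ℂ)‖ / κ) ^ 2)
    (fun t => by
      rw [norm_pow, norm_norm]
      gcongr
      exact norm_div_sub_le hκ (hmin t)) with hf
  have hcongr : ∀ m : Measure ℝ, (∀ᵐ t ∂m, κ ≤ s - t) → ∫ t, f t ∂m = sqIntegral m s := by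
    intro m hm
    refine integral_congr_ae ?_
    filter_upwards [hm] with t ht
    have : min t (s - κ) = t := min_eq_left (by linarith)
    simp [hf, this]
  rw [← hcongr ν hgap]
  refine (hνn f).congr' ?_
  filter_upwards [hgapn] with n hn using hcongr _ hn

/-! ### Integrals against the matrix-valued measures -/

section Matrices

variable {n : ℕ} {ι : Type}

lemma norm_integralLambda_le [Fintype ι] [DecidableEq ι] (d : Fin n → ℝ)
    (R : Matrix (Fin n) ι ℂ) {f : ℝ → ℝ} {C : ℝ} (hC : 0 ≤ C) (h : ∀ k, |f (d k)| ≤ C) :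
    ‖integralLambda d R f‖ ≤ C * ‖integralLambda d R fun _ => 1‖ := by
  have h1 : integralLambda d R (fun _ => 1) = Rᴴ * R := by simp [integralLambda]
  rw [h1, Matrix.l2_opNorm_conjTranspose_mul_self, integralLambda]
  have h2 : ‖(Matrix.diagonal fun k => (f (d k) : ℂ) : Matrix (Fin n) (Fin n) ℂ)‖ ≤ C := by
    rw [Matrix.l2_opNorm_diagonal]
    refine (pi_norm_le_iff_of_nonneg hC).2 fun k => ?_
    rw [Complex.norm_real]
    exact h k
  calc _ ≤ ‖Rᴴ * Matrix.diagonal fun k => (f (d k) : ℂ)‖ * ‖R‖ := Matrix.l2_opNorm_mul _ _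
    _ ≤ (‖Rᴴ‖ * ‖(Matrix.diagonal fun k => (f (d k) : ℂ) : Matrix (Fin n) (Fin n) ℂ)‖) * ‖R‖ := by
      gcongr
      exact Matrix.l2_opNorm_mul _ _
    _ ≤ (‖R‖ * C) * ‖R‖ := by
      rw [Matrix.l2_opNorm_conjTranspose]
      gcongr
    _ = C * (‖R‖ * ‖R‖) := by ring

lemma integralLambda_sub (d : Fin n → ℝ) (R : Matrix (Fin n) ι ℂ) (f f' : ℝ → ℝ) :
    integralLambda d R f - integralLambda d R f' = integralLambda d R fun t => f t - f' t := by
  simp only [integralLambda, ← Matrix.sub_mul, ← Matrix.mul_sub, Matrix.diagonal_sub]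
  push_cast
  rfl

lemma smul_integralLambda (d : Fin n → ℝ) (R : Matrix (Fin n) ι ℂ) (f : ℝ → ℝ) (a : ℝ) :
    (a : ℂ) • integralLambda d R f = integralLambda d R fun t => a * f t := by
  simp only [integralLambda]
  rw [← Matrix.smul_mul, ← Matrix.mul_smul, ← Matrix.diagonal_smul]
  congr 3
  ext k
  simp

/-- The integrand of `H` is `c'⁻¹ / (t - σ)` with `σ = -1 / (c' m)`; it is Lipschitz in `c'` and
`σ` as long as these stay away from zero and from `t` respectively. -/
lemma abs_integrand_sub_le {c c' m s t κ : ℝ} (hc : 0 < c) (hc' : c / 2 ≤ c') (hm : m ≠ 0)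
    (hκ : 0 < κ) (hst : κ ≤ s - t) (hσ : |-(c' * m)⁻¹ - s| ≤ κ / 2) :
    |m / (1 + c' * m * t) - c⁻¹ * (1 / (t - s))|
      ≤ 4 / (c ^ 2 * κ) * |c' - c| + 2 / (c * κ ^ 2) * |-(c' * m)⁻¹ - s| := by
  have hc'0 : 0 < c' := by linarith
  obtain ⟨σ, hσdef⟩ : ∃ σ, σ = -(c' * m)⁻¹ := ⟨_, rfl⟩
  rw [← hσdef] at hσ ⊢
  have h1 : κ / 2 ≤ σ - t := by linarith [(abs_le.1 hσ).1]
  have h2 : 0 < σ - t := by linarith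
  have h3 : 0 < s - t := by linarith
  have hm' : m / (1 + c' * m * t) = c'⁻¹ * (1 / (t - σ)) := by
    have h4 : 1 + c' * m * t ≠ 0 := IsLimitLaw.one_add_mul_ne_zero hc'0 hm hσdef h2.ne'
    have h5 : t - σ = (1 + c' * m * t) / (c' * m) := by
      rw [hσdef]
      field_simp
      ring
    rw [h5]
    field_simp
  have hsplit : m / (1 + c' * m * t) - c⁻¹ * (1 / (t - s))
      = (c' - c) * (1 / (c * c' * (σ - t))) + (σ - s) * (1 / (c * ((σ - t) * (s - t)))) := by
    rw [hm', ← neg_sub σ t, ← neg_sub s t]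
    field_simp
    ring
  rw [hsplit]
  refine (abs_add_le _ _).trans ?_
  rw [abs_mul, abs_mul, abs_of_pos (show 0 < 1 / (c * c' * (σ - t)) by positivity),
    abs_of_pos (show 0 < 1 / (c * ((σ - t) * (s - t))) by positivity),
    mul_comm |c' - c|, mul_comm |σ - s|]
  have h6 : 4 / (c ^ 2 * κ) = 1 / (c * (c / 2) * (κ / 2)) := by
    field_simp
    norm_num
  have h7 : 2 / (c * κ ^ 2) = 1 / (c * (κ / 2 * κ)) := by
    field_simp
  rw [h6, h7]
  gcongr

lemma norm_H_sub_le [Fintype ι] [DecidableEq ι] {c c' s κ ρ B : ℝ} {μ : Measure ℝ}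
    {d : Fin n → ℝ} {R : Matrix (Fin n) ι ℂ} (M : Matrix ι ι ℂ)
    (hc : 0 < c) (hc' : c / 2 ≤ c') (hm : stieltjes μ ρ ≠ 0) (hκ : 0 < κ)
    (hsd : ∀ k, κ ≤ s - d k) (hσ : |subord c' μ ρ - s| ≤ κ / 2)
    (hB : ‖integralLambda d R fun _ => 1‖ ≤ B) :
    ‖H c' μ d R ρ - (c⁻¹ : ℝ) • M‖ ≤
      (4 / (c ^ 2 * κ) * |c' - c| + 2 / (c * κ ^ 2) * |subord c' μ ρ - s|) * B
        + c⁻¹ * ‖integralLambda d R (fun t => 1 / (t - s)) - M‖ := by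
  have h1 : H c' μ d R ρ - (c⁻¹ : ℝ) • M
      = (integralLambda d R fun t => stieltjes μ ρ / (1 + c' * stieltjes μ ρ * t)
          - c⁻¹ * (1 / (t - s)))
        + ((c⁻¹ : ℝ) : ℂ) • (integralLambda d R (fun t => 1 / (t - s)) - M) := by
    rw [← integralLambda_sub, smul_sub, smul_integralLambda, H]
    have : ((c⁻¹ : ℝ) : ℂ) • M = (c⁻¹ : ℝ) • M := by
      ext a b
      simp
    rw [this]
    abel
  rw [h1]
  refine (norm_add_le _ _).trans (add_le_add ?_ ?_)
  · refine (norm_integralLambda_le d R (C := 4 / (c ^ 2 * κ) * |c' - c|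
      + 2 / (c * κ ^ 2) * |subord c' μ ρ - s|) (by positivity) fun k => ?_).trans (by gcongr)
    exact abs_integrand_sub_le hc hc' hm hκ (hsd k) hσ
  · rw [norm_smul, Complex.norm_real, Real.norm_eq_abs, abs_of_pos (by positivity)]

end Matrices

section Blocks

variable {t : ℕ} {j : Fin t → ℕ}

/-- Taking a diagonal block is a bounded operation for the spectral norm. -/
lemma exists_norm_blockDiag'_le (l : Fin t) :
    ∃ C : ℝ, 0 ≤ C ∧ ∀ A : Matrix (Σ l, Fin (j l)) (Σ l, Fin (j l)) ℂ,
      ‖Matrix.blockDiag' A l‖ ≤ C * ‖A‖ := by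
  let F : Matrix (Σ l, Fin (j l)) (Σ l, Fin (j l)) ℂ →ₗ[ℂ] Matrix (Fin (j l)) (Fin (j l)) ℂ :=
    { toFun := fun A => Matrix.blockDiag' A l
      map_add' := fun _ _ => rfl
      map_smul' := fun _ _ => rfl }
  exact ⟨‖LinearMap.toContinuousLinearMap F‖, norm_nonneg _,
    (LinearMap.toContinuousLinearMap F).le_opNorm⟩

lemma blockDiag'_smul_Omega (ω : Fin t → ℝ) (a : ℂ) (l : Fin t) :
    Matrix.blockDiag' (a • Omega j ω) l = (a * ((ω l ^ 2 : ℝ) : ℂ)) • 1 := by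
  ext x y
  by_cases hxy : x = y
  · subst hxy
    simp [Omega, Matrix.blockDiag'_apply]
  · simp [Omega, Matrix.blockDiag'_apply, hxy]

end Blocks

/-! ### Convergence at the outliers -/

lemma tendsto_zero_of_sqrt_mul_le {u : ℕ → ℝ} (h0 : ∀ n, 0 ≤ u n) {B : ℝ}
    (h : ∀ᶠ n : ℕ in atTop, √(n : ℝ) * u n ≤ B) : Tendsto u atTop (𝓝 0) := by
  have h1 : Tendsto (fun n : ℕ => √(n : ℝ)) atTop atTop :=
    Real.tendsto_sqrt_atTop.comp tendsto_natCast_atTop_atTop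
  refine squeeze_zero' (Eventually.of_forall h0) ?_ (h1.const_div_atTop B)
  filter_upwards [h, h1.eventually_gt_atTop 0] with n hn hpos
  rwa [le_div_iff₀ hpos, mul_comm]

/-- At a fixed real point `s` to the right of the support of `ν`, the left inverses of the
subordination functions for `(c, ν)` and `(c', ν')` differ by terms linear in `c' - c` and in the
difference of the Stieltjes transforms of `ν` and `ν'`. -/
lemma norm_subordInv_sub_le {c c' s κ κ' : ℝ} {ν ν' : Measure ℝ} [IsProbabilityMeasure ν]
    [IsProbabilityMeasure ν'] (hs : 0 < s) (hκ : 0 < κ) (hgap : ∀ᵐ t ∂ν, κ ≤ s - t)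
    (hκ' : 0 < κ') (hgap' : ∀ᵐ t ∂ν', κ' ≤ s - t) :
    ‖subordInv c ν s - subordInv c' ν' s‖
      ≤ s * |c' - c| + s ^ 2 * |stieltjes ν' s - stieltjes ν s| := by
  rw [subordInv_ofReal c hκ hgap, subordInv_ofReal c' hκ' hgap', ← Complex.ofReal_sub,
    Complex.norm_real, Real.norm_eq_abs]
  have h : c * s - s - s ^ 2 * stieltjes ν s - (c' * s - s - s ^ 2 * stieltjes ν' s)
      = -(s * (c' - c)) + s ^ 2 * (stieltjes ν' s - stieltjes ν s) := by ring
  rw [h]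
  refine (abs_add_le _ _).trans ?_
  rw [abs_neg, abs_mul, abs_mul, abs_of_pos hs, abs_of_pos (pow_pos hs 2)]

lemma eventually_gap {d : (n : ℕ) → Fin n → ℝ} {ν : Measure ℝ} [IsProbabilityMeasure ν]
    (hdist : Tendsto (fun n => ⨆ k : Fin n, Metric.infDist (d n k) ν.support) atTop (𝓝 0))
    {s κ : ℝ} (hκ : 0 < κ) (hgap : ∀ t ∈ ν.support, κ ≤ s - t) :
    ∀ᶠ n in atTop, ∀ k, κ / 2 ≤ s - d n k := by
  filter_upwards [hdist.eventually_lt_const (half_pos hκ)] with n hn k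
  have h1 : Metric.infDist (d n k) ν.support < κ / 2 :=
    (le_ciSup (f := fun k : Fin n => Metric.infDist (d n k) ν.support)
      (Set.finite_range _).bddAbove k).trans_lt hn
  obtain ⟨t, ht, hdt⟩ := (Metric.infDist_lt_iff
    (Measure.nonempty_support (IsProbabilityMeasure.ne_zero ν))).1 h1
  rw [Real.dist_eq] at hdt
  linarith [(abs_lt.1 hdt).2, hgap t ht]

/-- To the right of the support of the limit law, `H_n` converges to `-g Ω` at speed `√n`. -/
theorem outlier_convergence {N : ℕ → ℕ} {c : ℝ} (hc : 0 < c)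
    (hcn : Tendsto (fun n => (N n : ℝ) / n) atTop (𝓝 c))
    {d : (n : ℕ) → Fin n → ℝ}
    {ν : Measure ℝ} [IsProbabilityMeasure ν] (hν : IsCompact ν.support)
    (hνn : ∀ f : ℝ →ᵇ ℝ,
      Tendsto (fun n => ∫ x, f x ∂(empirical (d n))) atTop (𝓝 (∫ x, f x ∂ν)))
    (hdist : Tendsto (fun n => ⨆ k : Fin n, Metric.infDist (d n k) ν.support) atTop (𝓝 0))
    {μ : Measure ℝ} (hμ : IsLimitLaw c ν μ) {μn : ℕ → Measure ℝ}
    (hμn : ∀ n, 0 < n → IsLimitLaw ((N n : ℝ) / n) (empirical (d n)) (μn n))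
    {t : ℕ} {j : Fin t → ℕ} {ω : Fin t → ℝ}
    {R : (n : ℕ) → Matrix (Fin n) (Σ l, Fin (j l)) ℂ}
    (hΛ : ∀ f : ℝ →ᵇ ℝ,
      Tendsto (fun n => integralLambda (d n) (R n) f) atTop
        (𝓝 (((∫ x, f x ∂ν : ℝ) : ℂ) • Omega j ω)))
    (hcfast : BddAbove (Set.range fun n : ℕ => √(n : ℝ) * |(N n : ℝ) / n - c|))
    (hνfast : ∀ x : ℝ, x ∉ ν.support → LimsupFinite fun n =>
        √(n : ℝ) * |(∫ s, 1 / (s - x) ∂(empirical (d n))) - ∫ s, 1 / (s - x) ∂ν|)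
    (hΛfast : ∀ x : ℝ, x ∉ ν.support → LimsupFinite fun n =>
        √(n : ℝ) * ‖integralLambda (d n) (R n) (fun s => 1 / (s - x))
          - ((∫ s, 1 / (s - x) ∂ν : ℝ) : ℂ) • Omega j ω‖)
    {x : ℝ} (hx : x ∈ rightOfSupport μ) :
    (∀ᶠ n in atTop, x ∉ (μn n).support ∧
      ∀ k, 1 + (N n : ℝ) / n * stieltjes (μn n) x * d n k ≠ 0) ∧
    LimsupFinite fun n =>
      √(n : ℝ) * ‖H ((N n : ℝ) / n) (μn n) (d n) (R n) x + ((g c μ x : ℝ) : ℂ) • Omega j ω‖ := by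
  have := hμ.isProbabilityMeasure
  obtain ⟨κ₀, hκ₀, hgap₀⟩ := hμ.exists_gap_subord hc hν hx
  have hsν := hμ.subord_notMem_support hc hx
  have hs : 0 < subord c μ x := subord_pos hc hx
  have hgap₀' : ∀ᵐ t ∂ν, κ₀ ≤ subord c μ x - t :=
    Filter.mem_of_superset Measure.support_mem_ae hgap₀
  have hZ := hμ.subordInv_subord_of_mem_rightOfSupport hc hx hκ₀ hgap₀'
  have hSlt := hμ.sqIntegral_subord_lt hc hx hκ₀ hgap₀'
  have hg := hμ.g_eq hc hν hx
  have hgapn := eventually_gap hdist hκ₀ hgap₀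
  obtain ⟨B₁, hB₁⟩ := hcfast
  obtain ⟨B₂, hB₂⟩ := hνfast _ hsν
  obtain ⟨B₃, hB₃⟩ := hΛfast _ hsν
  rw [eventually_map] at hB₂ hB₃
  simp only [one_div, ← stieltjes_real] at hB₂
  set s := subord c μ x
  obtain ⟨κ, hκdef⟩ : ∃ κ, κ = κ₀ / 2 := ⟨_, rfl⟩
  have hκ : 0 < κ := by linarith
  rw [← hκdef] at hgapn
  obtain ⟨B₄, hB₄⟩ : ∃ B, ∀ᶠ n in atTop, ‖integralLambda (d n) (R n) fun _ => 1‖ ≤ B := by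
    have h1 := (hΛ (BoundedContinuousFunction.const ℝ 1)).norm
    exact ⟨_, (h1.eventually_lt_const (lt_add_one _)).mono fun n hn => hn.le⟩
  -- The constants of the stability estimate.
  set δ := (c - sqIntegral ν s) / 4 with hδdef
  have hδ : 0 < δ := by linarith
  set θ := min (1 / 2) (min (δ / (8 * c)) (s / (2 * κ))) with hθdef
  have hθ : 0 < θ := by positivity
  have hθ1 : θ ≤ 1 / 2 := min_le_left _ _
  have hθ2 : θ * (8 * c) ≤ δ := by
    rw [← le_div_iff₀ (by positivity)]
    exact (min_le_right _ _).trans (min_le_left _ _)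
  have hθ3 : θ * (2 * κ) ≤ s := by
    rw [← le_div_iff₀ (by positivity)]
    exact (min_le_right _ _).trans (min_le_right _ _)
  -- The error `E n` with which `s` solves the equation of the `n`-th law at `x`.
  set E : ℕ → ℝ := fun n => ‖(x : ℂ) - subordInv ((N n : ℝ) / n) (empirical (d n)) s‖ with hE
  have hEle : ∀ᶠ n : ℕ in atTop, √(n : ℝ) * E n ≤ s * B₁ + s ^ 2 * B₂ := by
    filter_upwards [hgapn, hB₂, eventually_gt_atTop 0] with n hn hn₂ hn0
    have := isProbabilityMeasure_empirical hn0 (d n)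
    have h1 := norm_subordInv_sub_le (c := c) (c' := (N n : ℝ) / n) hs hκ₀ hgap₀' hκ
      (ae_empirical (p := fun t => κ ≤ s - t) hn)
    have h2 := hB₁ ⟨n, rfl⟩
    simp only at h2
    rw [hZ] at h1
    calc √(n : ℝ) * E n ≤ √(n : ℝ) * (s * |(N n : ℝ) / n - c|
          + s ^ 2 * |stieltjes (empirical (d n)) s - stieltjes ν s|) := by gcongr
      _ = s * (√(n : ℝ) * |(N n : ℝ) / n - c|)
          + s ^ 2 * (√(n : ℝ) * |stieltjes (empirical (d n)) s - stieltjes ν s|) := by ring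
      _ ≤ s * B₁ + s ^ 2 * B₂ := by gcongr
  have hE0 : Tendsto E atTop (𝓝 0) := tendsto_zero_of_sqrt_mul_le (fun n => norm_nonneg _) hEle
  have hSn : Tendsto (fun n => (N n : ℝ) / n - sqIntegral (empirical (d n)) s) atTop
      (𝓝 (c - sqIntegral ν s)) :=
    hcn.sub (tendsto_sqIntegral hνn hκ (hgap₀'.mono fun t ht => by linarith)
      (hgapn.mono fun n hn => ae_empirical (p := fun t => κ ≤ s - t) hn))
  have hmain : ∀ᶠ n in atTop, c / 2 ≤ (N n : ℝ) / n ∧ x ∉ (μn n).support ∧ stieltjes (μn n) x ≠ 0 ∧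
      |subord ((N n : ℝ) / n) (μn n) x - s| ≤ κ / 2 ∧
      δ * |subord ((N n : ℝ) / n) (μn n) x - s| ≤ E n := by
    filter_upwards [hgapn, eventually_gt_atTop 0, hcn.eventually_const_lt (half_lt_self hc),
      hcn.eventually_lt_const (show c < 2 * c by linarith),
      hSn.eventually_const_lt (show 2 * δ < c - sqIntegral ν s by linarith),
      hE0.eventually_lt_const (show 0 < δ * (θ * κ) / 2 by positivity)] with n h1 h2 h3 h4 h5 h6
    have := isProbabilityMeasure_empirical h2 (d n)
    obtain ⟨h7, h8, h9⟩ := (hμn n h2).outlier_stable (lt_trans (half_pos hc) h3) hs hκ hδ hθ hθ1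
      (by nlinarith) (by linarith) (ae_empirical (p := fun t => κ ≤ s - t) h1) (by linarith) h6.le
    refine ⟨h3.le, h7, h8, ?_, h9⟩
    have h10 : δ * |subord ((N n : ℝ) / n) (μn n) x - s| ≤ δ * (θ * κ / 2) := by linarith
    have h11 := le_of_mul_le_mul_left h10 hδ
    nlinarith
  refine ⟨?_, ?_⟩
  · filter_upwards [hmain, hgapn] with n ⟨h1, h2, h3, h4, _⟩ h5
    refine ⟨h2, fun k => IsLimitLaw.one_add_mul_ne_zero (by linarith) h3 rfl (ne_of_gt ?_)⟩
    rw [← subord_real]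
    linarith [(abs_le.1 h4).1, h5 k]
  · refine ⟨(4 / (c ^ 2 * κ) * B₁ + 2 / (c * κ ^ 2) * ((s * B₁ + s ^ 2 * B₂) / δ)) * B₄
      + c⁻¹ * B₃, ?_⟩
    rw [eventually_map]
    filter_upwards [hmain, hgapn, hEle, hB₃, hB₄] with n ⟨h1, h2, h3, h4, h5⟩ h6 h7 h8 h9
    have h10 := hB₁ ⟨n, rfl⟩
    simp only at h10
    have h11 := norm_H_sub_le (R := R n) (((∫ r, 1 / (r - s) ∂ν : ℝ) : ℂ) • Omega j ω)
      hc h1 h3 hκ h6 h4 h9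
    have h12 : H ((N n : ℝ) / n) (μn n) (d n) (R n) x + ((g c μ x : ℝ) : ℂ) • Omega j ω
        = H ((N n : ℝ) / n) (μn n) (d n) (R n) x
          - (c⁻¹ : ℝ) • (((∫ r, 1 / (r - s) ∂ν : ℝ) : ℂ) • Omega j ω) := by
      rw [sub_eq_add_neg, hg, stieltjes_real]
      congr 1
      rw [← Complex.coe_smul, smul_smul, ← neg_smul]
      congr 1
      simp only [one_div]
      push_cast
      ring
    have h13 : √(n : ℝ) * |subord ((N n : ℝ) / n) (μn n) x - s| ≤ (s * B₁ + s ^ 2 * B₂) / δ := by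
      rw [le_div_iff₀ hδ]
      calc _ = √(n : ℝ) * (δ * |subord ((N n : ℝ) / n) (μn n) x - s|) := by ring
        _ ≤ √(n : ℝ) * E n := by gcongr
        _ ≤ _ := h7
    have h14 : 0 ≤ B₄ := (norm_nonneg _).trans h9
    rw [h12]
    calc _ ≤ √(n : ℝ) * ((4 / (c ^ 2 * κ) * |(N n : ℝ) / n - c|
            + 2 / (c * κ ^ 2) * |subord ((N n : ℝ) / n) (μn n) x - s|) * B₄
          + c⁻¹ * ‖integralLambda (d n) (R n) (fun t => 1 / (t - s))
            - ((∫ r, 1 / (r - s) ∂ν : ℝ) : ℂ) • Omega j ω‖) := by gcongr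
      _ = (4 / (c ^ 2 * κ) * (√(n : ℝ) * |(N n : ℝ) / n - c|)
            + 2 / (c * κ ^ 2) * (√(n : ℝ) * |subord ((N n : ℝ) / n) (μn n) x - s|)) * B₄
          + c⁻¹ * (√(n : ℝ) * ‖integralLambda (d n) (R n) (fun t => 1 / (t - s))
            - ((∫ r, 1 / (r - s) ∂ν : ℝ) : ℂ) • Omega j ω‖) := by ring
      _ ≤ _ := by gcongr

end Spiked

end

theorem proposition5
    -- the dimensions, with ratio `N n / n` tending to `c > 0`
    (N : ℕ → ℕ) (c : ℝ) (hc : 0 < c)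
    (hcn : Tendsto (fun n => (N n : ℝ) / n) atTop (𝓝 c))
    -- the diagonal nonnegative matrices `D_n` and the limit `ν` of their spectral measures
    (d : (n : ℕ) → Fin n → ℝ) (hd : ∀ n k, 0 ≤ d n k)
    (ν : Measure ℝ) [IsProbabilityMeasure ν] (hν : IsCompact ν.support)
    (hνn : ∀ f : ℝ →ᵇ ℝ,
      Tendsto (fun n => ∫ x, f x ∂(Spiked.empirical (d n))) atTop (𝓝 (∫ x, f x ∂ν)))
    (hdist : Tendsto (fun n => ⨆ k : Fin n, Metric.infDist (d n k) ν.support) atTop (𝓝 0))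
    -- the limiting measure `μ` and its finite-`n` approximations `μ_n`
    (μ : Measure ℝ) (hμ : Spiked.IsLimitLaw c ν μ)
    (μn : ℕ → Measure ℝ)
    (hμn : ∀ n, 0 < n → Spiked.IsLimitLaw ((N n : ℝ) / n) (Spiked.empirical (d n)) (μn n))
    -- the matrix `Ω`
    (t : ℕ) (ht : 0 < t) (j : Fin t → ℕ) (hj : ∀ l, 0 < j l)
    (ω : Fin t → ℝ) (hω : ∀ l, 0 < ω l ^ 2) (hωanti : StrictAnti fun l => ω l ^ 2)
    -- the deformations `P_n`, of rank `r = j_1 + ⋯ + j_t`, and factorizations `P_n = U_n R_n*`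
    (P : (n : ℕ) → Matrix (Fin (N n)) (Fin n) ℂ)
    (hPrank : ∀ᶠ n in atTop, (P n).rank = ∑ l, j l)
    (hPbdd : BddAbove (Set.range fun n => ‖P n‖))
    (U : (n : ℕ) → Matrix (Fin (N n)) (Σ l, Fin (j l)) ℂ)
    (R : (n : ℕ) → Matrix (Fin n) (Σ l, Fin (j l)) ℂ)
    (hU : ∀ᶠ n in atTop, (U n)ᴴ * U n = 1)
    (hUR : ∀ᶠ n in atTop, P n = U n * (R n)ᴴ)
    -- the associated measures `Λ_n` converge to `ν × Ω`
    (hΛ : ∀ f : ℝ →ᵇ ℝ,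
      Tendsto (fun n => Spiked.integralLambda (d n) (R n) f) atTop
        (𝓝 (((∫ x, f x ∂ν : ℝ) : ℂ) • Spiked.Omega j ω)))
    -- the convergence rates
    (hcfast : BddAbove (Set.range fun n : ℕ => √(n : ℝ) * |(N n : ℝ) / n - c|))
    (hνfast : ∀ x : ℝ, x ∉ ν.support →
      Spiked.LimsupFinite fun n =>
        √(n : ℝ) * |(∫ s, 1 / (s - x) ∂(Spiked.empirical (d n))) - ∫ s, 1 / (s - x) ∂ν|)
    (hΛfast : ∀ x : ℝ, x ∉ ν.support →
      Spiked.LimsupFinite fun n =>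
        √(n : ℝ) * ‖Spiked.integralLambda (d n) (R n) (fun s => 1 / (s - x))
          - ((∫ s, 1 / (s - x) ∂ν : ℝ) : ℂ) • Spiked.Omega j ω‖)
    -- the equation `ω_1² g(x) = 1` has a solution to the right of the support of `μ`
    (hsol : ∃ x ∈ Spiked.rightOfSupport μ, ω ⟨0, ht⟩ ^ 2 * Spiked.g c μ x = 1) :
    ∃ (p : ℕ) (hp : p ≤ t) (ρ : Fin p → ℝ),
      -- `ρ_1 > ⋯ > ρ_p` are all the solutions to the right of the support of `μ`, and `ρ_i`
      -- solves the equation with `ω_i²` (and no other)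
      0 < p ∧ StrictAnti ρ ∧ (∀ i, ρ i ∈ Spiked.rightOfSupport μ) ∧
      (∀ x ∈ Spiked.rightOfSupport μ, ∀ l : Fin t,
        ω l ^ 2 * Spiked.g c μ x = 1 ↔ ∃ i : Fin p, Fin.castLE hp i = l ∧ ρ i = x) ∧
      -- `Δ(ρ_i)` is well defined (its integrand is continuous on the support of `ν`) and positive
      (∀ i, (∀ s ∈ ν.support, 1 + c * Spiked.stieltjes μ (ρ i) * s ≠ 0) ∧
        0 < Spiked.Delta c ν μ (ρ i)) ∧
      (∀ i,
        -- `H_n(ρ_i)` is well defined for all large `n`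
        (∀ᶠ n in atTop, ρ i ∉ (μn n).support ∧
          ∀ k, 1 + (N n : ℝ) / n * Spiked.stieltjes (μn n) (ρ i) * d n k ≠ 0) ∧
        -- the `i`-th diagonal block of `H_n(ρ_i)` tends to `-I` at speed `√n`
        Spiked.LimsupFinite fun n =>
          ‖(√(n : ℝ) : ℂ) •
            (Matrix.blockDiag'
              (Spiked.H ((N n : ℝ) / n) (μn n) (d n) (R n) (ρ i)) (Fin.castLE hp i) + 1)‖) := by
  obtain ⟨p, hp, ρ, hp0, hanti, hmem, hiff⟩ := Spiked.exists_decreasing_solutions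
    (hμ.g_strictAntiOn hc hν) (fun x hx a ha hax => hμ.exists_g_eq hc hν hx ha hax) ht hω
    hωanti hsol
  refine ⟨p, hp, ρ, hp0, hanti, hmem, hiff, fun i => ⟨fun s hs => ?_, hμ.Delta_pos hc hν (hmem i)⟩,
    fun i => ?_⟩
  · have := hμ.isProbabilityMeasure
    exact Spiked.IsLimitLaw.one_add_mul_ne_zero hc (Spiked.stieltjes_neg (hmem i)).ne
      (Spiked.subord_real c μ (ρ i)) (sub_pos.2 (hμ.lt_subord hc hν (hmem i) hs)).ne'
  · obtain ⟨h1, B, hB⟩ := Spiked.outlier_convergence hc hcn hν hνn hdist hμ hμn hΛ hcfast hνfast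
      hΛfast (hmem i)
    refine ⟨h1, ?_⟩
    set l := Fin.castLE hp i with hl
    have hroot : ω l ^ 2 * Spiked.g c μ (ρ i) = 1 := (hiff _ (hmem i) l).2 ⟨i, rfl, rfl⟩
    obtain ⟨C, hC, hblock⟩ := Spiked.exists_norm_blockDiag'_le (j := j) l
    refine ⟨C * B, ?_⟩
    rw [eventually_map] at hB ⊢
    filter_upwards [hB] with n hn
    have h2 : Matrix.blockDiag' (Spiked.H ((N n : ℝ) / n) (μn n) (d n) (R n) (ρ i)) l + 1
        = Matrix.blockDiag' (Spiked.H ((N n : ℝ) / n) (μn n) (d n) (R n) (ρ i)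
          + ((Spiked.g c μ (ρ i) : ℝ) : ℂ) • Spiked.Omega j ω) l := by
      rw [Matrix.blockDiag'_add, Pi.add_apply, Spiked.blockDiag'_smul_Omega, ← Complex.ofReal_mul,
        mul_comm, hroot, Complex.ofReal_one, one_smul]
    rw [h2, norm_smul, Complex.norm_real, Real.norm_eq_abs, abs_of_nonneg (Real.sqrt_nonneg _)]
    calc _ ≤ √(n : ℝ) * (C * ‖Spiked.H ((N n : ℝ) / n) (μn n) (d n) (R n) (ρ i)
          + ((Spiked.g c μ (ρ i) : ℝ) : ℂ) • Spiked.Omega j ω‖) := by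
          gcongr
          exact hblock _
      _ = C * (√(n : ℝ) * ‖Spiked.H ((N n : ℝ) / n) (μn n) (d n) (R n) (ρ i)
          + ((Spiked.g c μ (ρ i) : ℝ) : ℂ) • Spiked.Omega j ω‖) := by ring
      _ ≤ C * B := by gcongr
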